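/- Let $\mathcal{O}$ be a complete discrete valuation ring with uniformizer $\varepsilon$ and algebraically closed residue field $\kappa$, and let $A=\mathcal{O}[X,Y]/(X^2,Y^2)$. An $A$-lattice is an $A$-module that is free of finite rank over $\mathcal{O}$. A morphism of $A$-lattices is irreducible if it is neither a section (split monomorphism) nor a retraction (split epimorphism) and, whenever it factors as $f_2\circ f_1$ through an $A$-lattice, $f_1$ is a section or $f_2$ is a retraction. A short exact sequence $0\to L\xrightarrow{f}M\xrightarrow{g}N\to 0$ of $A$-lattices is an almost split sequence ending at $N$ if $f$ and $g$ are irreducible and $L$ and $N$ are indecomposable. For $n\ge 1$ and $\lambda\in\kappa$ let $M(\lambda)_n=\kappa^n\oplus\kappa^n$ be the $A$-module with basis $u_1,\dots,u_n,v_1,\dots,v_n$ on which $\mathcal{O}$ acts through $\kappa$ and $Xu_i=v_i$, $Yu_i=\lambda v_i+v_{i-1}$ (with $v_0=0$), $Xv_i=Yv_i=0$. Let $Z_n^{\lambda}$ be the kernel of the surjection $A^n\to M(\lambda)_n$, $e_i\mapsto u_i$. Fix a lift of $\lambda$ to $\mathcal{O}$, again denoted by $\lambda$, and put, for $1\le k\le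 n$ (with $e_0=0$), \[ \mathsf{a}_{k,1}=\varepsilon e_k,\qquad \mathsf{a}_{k,3}=Ye_k-\lambda Xe_k-Xe_{k-1},\qquad \mathsf{a}_{k,4}=XYe_k , \] which are elements of $Z_n^{\lambda}$. Let $\pi_{n,\lambda}:A^{2n}\to Z_n^{\lambda}$ be the $A$-homomorphism with $e_{2k-1}\mapsto \mathsf{a}_{k,1}$ and $e_{2k}\mapsto\mathsf{a}_{k,3}$ for $1\le k\le n$. Let $\Phi_n^{\lambda}$ be the $A$-endomorphism of $Z_n^{\lambda}$ with $\mathsf{a}_{n,1}\mapsto\mathsf{a}_{n,4}$ and $\mathsf{a}_{k,1}\mapsto 0$ for $k<n$; explicitly, it sends $z$ to $t\,\mathsf{a}_{n,4}$, where $\varepsilon t$ is the constant coefficient of the $n$-th coordinate of $z\in A^n$. Put \[ E_n^{\lambda}=\{(x,y)\in A^{2n}\oplus Z_n^{\lambda}\mid \pi_{n,\lambda}(x)=\Phi_n^{\lambda}(y)\}. \] Then $\pi_{n,\lambda}$ is a projective cover, and its kernel is isomorphic to $Z_n^{-\lambda}$, so that there is an exact sequence $0\to Z_n^{-\lambda}\xrightarrow{\iota}A^{2n}\xrightarrow{\pi_{n,\lambda}}Z_n^{\lambda}\to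 0$. For every such $\iota$, the pullback of this sequence along $\Phi_n^{\lambda}$, that is, the sequence \[ 0\to Z_n^{-\lambda}\to E_n^{\lambda}\to Z_n^{\lambda}\to 0 \] with maps $z\mapsto(\iota(z),0)$ and $(x,y)\mapsto y$, is an almost split sequence ending at $Z_n^{\lambda}$. -/

import Mathlib

universe u

namespace SymKron

noncomputable section

/-! ### Lattices over an algebra over a commutative ring, almost split sequences -/

section Lattices

/-- An `R`-lattice: an `R`-module that is free of finite rank over the base ring `O`. -/
def IsLattice (O : Type u) (W : Type u) [CommRing O] [AddCommGroup W] [Module O W] : Prop :=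
  Module.Free O W ∧ Module.Finite O W

variable (O : Type u) {R : Type u} [CommRing O] [CommRing R] [Algebra O R]
variable {L M N : Type u} [AddCommGroup L] [AddCommGroup M] [AddCommGroup N]
variable [Module R L] [Module R M] [Module R N]

/-- `f` is a section (split monomorphism). -/
def IsSection (f : M →ₗ[R] N) : Prop := ∃ r : N →ₗ[R] M, r ∘ₗ f = LinearMap.id

/-- `f` is a retraction (split epimorphism). -/
def IsRetraction (f : M →ₗ[R] N) : Prop := ∃ s : N →ₗ[R] M, f ∘ₗ s = LinearMap.id

/-- `f` is an irreducible morphism of the category of `R`-lattices: it is neither a section nor a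
retraction, and whenever it factors as `f₂ ∘ f₁` through an `R`-lattice, `f₁` is a section or
`f₂` is a retraction. -/
def IsIrreducibleMap (f : M →ₗ[R] N) : Prop :=
  ¬ IsSection f ∧ ¬ IsRetraction f ∧
    ∀ (W : Type u) [AddCommGroup W] [Module O W] [Module R W] [IsScalarTower O R W],
      IsLattice O W → ∀ (f₁ : M →ₗ[R] W) (f₂ : W →ₗ[R] N), f = f₂ ∘ₗ f₁ →
        IsSection f₁ ∨ IsRetraction f₂

variable (R M) in
/-- `M` is an indecomposable `R`-module. -/
def IsIndecomposable : Prop :=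
  Nontrivial M ∧ ∀ P Q : Submodule R M, IsCompl P Q → P = ⊥ ∨ Q = ⊥

variable (R L M N) in
/-- `0 → L → M → N → 0` (with maps `f` and `g`) is an almost split sequence of `R`-lattices. -/
structure IsAlmostSplit [Module O L] [Module O M] [Module O N]
    [IsScalarTower O R L] [IsScalarTower O R M] [IsScalarTower O R N]
    (f : L →ₗ[R] M) (g : M →ₗ[R] N) : Prop where
  lattice_left : IsLattice O L
  lattice_middle : IsLattice O M
  lattice_right : IsLattice O N
  injective : Function.Injective f
  exact : Function.Exact f g
  surjective : Function.Surjective g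
  irreducible_left : IsIrreducibleMap O f
  irreducible_right : IsIrreducibleMap O g
  indecomposable_left : IsIndecomposable R L
  indecomposable_right : IsIndecomposable R N

/-- `p : P → M` is a projective cover: `P` is projective, `p` is surjective and its kernel is
superfluous. -/
def IsProjectiveCover (p : M →ₗ[R] N) : Prop :=
  Module.Projective R M ∧ Function.Surjective p ∧
    ∀ Q : Submodule R M, LinearMap.ker p ⊔ Q = ⊤ → Q = ⊤

/-- The pullback of `p : M → N` along `φ : L → N`, as a submodule of `M × L`. -/
def pullback (p : M →ₗ[R] N) (φ : L →ₗ[R] N) : Submodule R (M × L) :=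
  LinearMap.eqLocus (p ∘ₗ LinearMap.fst R M L) (φ ∘ₗ LinearMap.snd R M L)

/-- The projection from the pullback to `L`. -/
def pullbackSnd (p : M →ₗ[R] N) (φ : L →ₗ[R] N) : pullback p φ →ₗ[R] L :=
  LinearMap.snd R M L ∘ₗ (pullback p φ).subtype

/-- The map `K → pullback`, `x ↦ (ι x, 0)`, induced by `ι : K → M` with `p ∘ ι = 0`. -/
def pullbackLift {K : Type u} [AddCommGroup K] [Module R K] (p : M →ₗ[R] N) (φ : L →ₗ[R] N)
    (ι : K →ₗ[R] M) (h : p ∘ₗ ι = 0) : K →ₗ[R] pullback p φ :=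
  LinearMap.codRestrict (pullback p φ) (LinearMap.inl R M L ∘ₗ ι) (fun x => by
    have hx : p (ι x) = 0 := LinearMap.congr_fun h x
    simp [pullback, hx])

end Lattices

/-! ### The symmetric Kronecker algebra -/

section Algebra

variable (O : Type u) [CommRing O]

/-- The algebra `A = O[X, Y] / (X², Y²)`. -/
abbrev A : Type u :=
  MvPolynomial (Fin 2) O ⧸
    (Ideal.span {MvPolynomial.X 0 ^ 2, MvPolynomial.X 1 ^ 2} : Ideal (MvPolynomial (Fin 2) O))

/-- The class of `X` in `A`. -/
def x : A O := Ideal.Quotient.mk _ (MvPolynomial.X 0)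

/-- The class of `Y` in `A`. -/
def y : A O := Ideal.Quotient.mk _ (MvPolynomial.X 1)

/-- The coordinate homomorphism, sending `a + b X + c Y + d XY` to `(a + b δ) + (c + d δ) δ'`,
where `δ`, `δ'` are the two dual number variables. -/
def coord : A O →ₐ[O] DualNumber (DualNumber O) :=
  Ideal.Quotient.liftₐ _
    (MvPolynomial.aeval (R := O) (S₁ := DualNumber (DualNumber O))
      ![TrivSqZeroExt.inl DualNumber.eps, DualNumber.eps])
    (fun a ha => by
      have hle : (Ideal.span {MvPolynomial.X 0 ^ 2, MvPolynomial.X 1 ^ 2} :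
          Ideal (MvPolynomial (Fin 2) O)) ≤ RingHom.ker
          (MvPolynomial.aeval (R := O) (S₁ := DualNumber (DualNumber O))
            ![TrivSqZeroExt.inl DualNumber.eps, DualNumber.eps]) := by
        rw [Ideal.span_le]
        rintro p (rfl | rfl)
        · simp [RingHom.mem_ker, pow_two, ← TrivSqZeroExt.inl_mul]
        · simp [RingHom.mem_ker, pow_two]
      exact hle ha)

variable {O}

/-- The coefficient of `1`. -/
def c0 (a : A O) : O := (coord O a).fst.fst

/-- The coefficient of `X`. -/
def cX (a : A O) : O := (coord O a).fst.snd

/-- The coefficient of `Y`. -/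
def cY (a : A O) : O := (coord O a).snd.fst

theorem coord_x : coord O (x O) = TrivSqZeroExt.inl DualNumber.eps := by
  exact (MvPolynomial.aeval_X _ 0)

theorem coord_y : coord O (y O) = DualNumber.eps := by
  exact (MvPolynomial.aeval_X _ 1)

@[simp] theorem c0_zero : c0 (0 : A O) = 0 := by simp [c0]
@[simp] theorem cX_zero : cX (0 : A O) = 0 := by simp [cX]
@[simp] theorem cY_zero : cY (0 : A O) = 0 := by simp [cY]
@[simp] theorem c0_one : c0 (1 : A O) = 1 := by simp [c0]
@[simp] theorem cX_one : cX (1 : A O) = 0 := by simp [cX]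
@[simp] theorem cY_one : cY (1 : A O) = 0 := by simp [cY]
@[simp] theorem c0_x : c0 (x O) = 0 := by simp [c0, coord_x]
@[simp] theorem cX_x : cX (x O) = 1 := by simp [cX, coord_x]
@[simp] theorem cY_x : cY (x O) = 0 := by simp [cY, coord_x]
@[simp] theorem c0_y : c0 (y O) = 0 := by simp [c0, coord_y]
@[simp] theorem cX_y : cX (y O) = 0 := by simp [cX, coord_y]
@[simp] theorem cY_y : cY (y O) = 1 := by simp [cY, coord_y]
@[simp] theorem c0_add (a b : A O) : c0 (a + b) = c0 a + c0 b := by simp [c0]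
@[simp] theorem cX_add (a b : A O) : cX (a + b) = cX a + cX b := by simp [cX]
@[simp] theorem cY_add (a b : A O) : cY (a + b) = cY a + cY b := by simp [cY]
@[simp] theorem c0_sub (a b : A O) : c0 (a - b) = c0 a - c0 b := by simp [c0]
@[simp] theorem cX_sub (a b : A O) : cX (a - b) = cX a - cX b := by simp [cX]
@[simp] theorem cY_sub (a b : A O) : cY (a - b) = cY a - cY b := by simp [cY]
@[simp] theorem c0_neg (a : A O) : c0 (-a) = -c0 a := by simp [c0]
@[simp] theorem cX_neg (a : A O) : cX (-a) = -cX a := by simp [cX]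
@[simp] theorem cY_neg (a : A O) : cY (-a) = -cY a := by simp [cY]
@[simp] theorem c0_mul (a b : A O) : c0 (a * b) = c0 a * c0 b := by simp [c0]
@[simp] theorem cX_mul (a b : A O) : cX (a * b) = c0 a * cX b + cX a * c0 b := by
  simp [c0, cX, mul_comm]
@[simp] theorem cY_mul (a b : A O) : cY (a * b) = c0 a * cY b + cY a * c0 b := by
  simp [c0, cY, mul_comm]
@[simp] theorem c0_smul (r : O) (b : A O) : c0 (r • b) = r * c0 b := by simp [c0]
@[simp] theorem cX_smul (r : O) (b : A O) : cX (r • b) = r * cX b := by simp [cX]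
@[simp] theorem cY_smul (r : O) (b : A O) : cY (r • b) = r * cY b := by simp [cY]

theorem x_mul_x : x O * x O = 0 := by
  rw [x, ← map_mul, Ideal.Quotient.eq_zero_iff_mem, ← pow_two]
  exact Ideal.subset_span (by simp)

theorem y_mul_y : y O * y O = 0 := by
  rw [y, ← map_mul, Ideal.Quotient.eq_zero_iff_mem, ← pow_two]
  exact Ideal.subset_span (by simp)

theorem mul_x_mul_y (a : A O) : a * (x O * y O) = c0 a • (x O * y O) := by
  obtain ⟨p, rfl⟩ := Ideal.Quotient.mk_surjective a
  induction p using MvPolynomial.induction_on with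
  | C r =>
    have h : (Ideal.Quotient.mk _ (MvPolynomial.C r) : A O) = r • (1 : A O) :=
      (Algebra.algebraMap_eq_smul_one (A := A O) r)
    rw [h]; simp
  | add p q hp hq => rw [map_add, add_mul, hp, hq, c0_add, add_smul]
  | mul_X p i hp =>
    rw [map_mul, c0_mul]
    fin_cases i
    · change _ * x O * (x O * y O) = (_ * c0 (x O)) • _
      rw [mul_assoc, ← mul_assoc (x O), x_mul_x]; simp
    · change _ * y O * (x O * y O) = (_ * c0 (y O)) • _
      rw [mul_assoc, mul_left_comm (y O), y_mul_y]; simp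

end Algebra

/-! ### The modules `M(c)ₙ` over the residue field and the Heller lattices -/

section Heller

variable (O : Type u) [CommRing O] [IsLocalRing O]

local notation "κ" => IsLocalRing.ResidueField O

variable {O} in
/-- The upper triangular Jordan block `J(c, n)`. -/
def jordan (n : ℕ) (c : κ) : Matrix (Fin n) (Fin n) κ :=
  Matrix.of fun i j => if i = j then c else if i.val + 1 = j.val then 1 else 0

variable {O} in
/-- The underlying space `κⁿ ⊕ κⁿ` of the module `M(c)ₙ`; its first summand has the basis
`u₁, …, uₙ`, its second one the basis `v₁, …, vₙ`. -/
def Mod (n : ℕ) (_c : κ) : Type u := (Fin n → κ) × (Fin n → κ)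

instance (n : ℕ) (c : κ) : AddCommGroup (Mod n c) :=
  inferInstanceAs (AddCommGroup ((Fin n → κ) × (Fin n → κ)))

/-- The action of `A` on `M(c)ₙ`: `X` acts as the block matrix `(0, 0; 1, 0)`, `Y` as
`(0, 0; J(c, n), 0)`, `XY` as `0`, and `O` through its residue field. -/
instance (n : ℕ) (c : κ) : Module (A O) (Mod n c) where
  smul a m :=
    (IsLocalRing.residue O (c0 a) • m.1,
      IsLocalRing.residue O (c0 a) • m.2 + IsLocalRing.residue O (cX a) • m.1 +
        IsLocalRing.residue O (cY a) • (jordan n c).mulVec m.1)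
  one_smul m := by
    refine Prod.ext ?_ ?_
    · change IsLocalRing.residue O (c0 1) • m.1 = m.1
      simp
    · change IsLocalRing.residue O (c0 1) • m.2 + IsLocalRing.residue O (cX 1) • m.1 +
        IsLocalRing.residue O (cY 1) • (jordan n c).mulVec m.1 = m.2
      simp
  mul_smul a b m := by
    refine Prod.ext ?_ ?_
    · change IsLocalRing.residue O (c0 (a * b)) • m.1 =
        IsLocalRing.residue O (c0 a) • IsLocalRing.residue O (c0 b) • m.1
      simp [mul_smul]
    · change IsLocalRing.residue O (c0 (a * b)) • m.2 +
          IsLocalRing.residue O (cX (a * b)) • m.1 +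
          IsLocalRing.residue O (cY (a * b)) • (jordan n c).mulVec m.1 =
        IsLocalRing.residue O (c0 a) • (IsLocalRing.residue O (c0 b) • m.2 +
          IsLocalRing.residue O (cX b) • m.1 +
          IsLocalRing.residue O (cY b) • (jordan n c).mulVec m.1) +
        IsLocalRing.residue O (cX a) • IsLocalRing.residue O (c0 b) • m.1 +
        IsLocalRing.residue O (cY a) •
          (jordan n c).mulVec (IsLocalRing.residue O (c0 b) • m.1)
      simp only [c0_mul, cX_mul, cY_mul, map_mul, map_add, Matrix.mulVec_smul]
      module
  smul_zero a := by
    refine Prod.ext ?_ ?_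
    · change IsLocalRing.residue O (c0 a) • (0 : Fin n → κ) = 0
      simp
    · change IsLocalRing.residue O (c0 a) • (0 : Fin n → κ) +
        IsLocalRing.residue O (cX a) • (0 : Fin n → κ) +
        IsLocalRing.residue O (cY a) • (jordan n c).mulVec 0 = 0
      simp
  smul_add a m m' := by
    refine Prod.ext ?_ ?_
    · change IsLocalRing.residue O (c0 a) • (m.1 + m'.1) = _ • m.1 + _ • m'.1
      simp
    · change IsLocalRing.residue O (c0 a) • (m.2 + m'.2) +
          IsLocalRing.residue O (cX a) • (m.1 + m'.1) +
          IsLocalRing.residue O (cY a) • (jordan n c).mulVec (m.1 + m'.1) =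
        (IsLocalRing.residue O (c0 a) • m.2 + IsLocalRing.residue O (cX a) • m.1 +
          IsLocalRing.residue O (cY a) • (jordan n c).mulVec m.1) +
        (IsLocalRing.residue O (c0 a) • m'.2 + IsLocalRing.residue O (cX a) • m'.1 +
          IsLocalRing.residue O (cY a) • (jordan n c).mulVec m'.1)
      rw [Matrix.mulVec_add]
      module
  add_smul a b m := by
    refine Prod.ext ?_ ?_
    · change IsLocalRing.residue O (c0 (a + b)) • m.1 = _ • m.1 + _ • m.1
      simp [add_smul]
    · change IsLocalRing.residue O (c0 (a + b)) • m.2 +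
          IsLocalRing.residue O (cX (a + b)) • m.1 +
          IsLocalRing.residue O (cY (a + b)) • (jordan n c).mulVec m.1 =
        (IsLocalRing.residue O (c0 a) • m.2 + IsLocalRing.residue O (cX a) • m.1 +
          IsLocalRing.residue O (cY a) • (jordan n c).mulVec m.1) +
        (IsLocalRing.residue O (c0 b) • m.2 + IsLocalRing.residue O (cX b) • m.1 +
          IsLocalRing.residue O (cY b) • (jordan n c).mulVec m.1)
      simp only [c0_add, cX_add, cY_add, map_add]
      module
  zero_smul m := by
    refine Prod.ext ?_ ?_
    · change IsLocalRing.residue O (c0 0) • m.1 = 0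
      simp
    · change IsLocalRing.residue O (c0 0) • m.2 + IsLocalRing.residue O (cX 0) • m.1 +
        IsLocalRing.residue O (cY 0) • (jordan n c).mulVec m.1 = 0
      simp

variable {O}

/-- The basis vector `uᵢ` of `M(c)ₙ`. -/
def u (n : ℕ) (c : κ) (i : Fin n) : Mod n c := (Pi.single i 1, 0)

/-- The projective cover `Aⁿ → M(c)ₙ`, `eᵢ ↦ uᵢ`. -/
def cover (n : ℕ) (c : κ) : (Fin n → A O) →ₗ[A O] Mod n c :=
  Fintype.linearCombination (A O) (u n c)

/-- The Heller lattice `Zₙᶜ`, the kernel of the projective cover `Aⁿ → M(c)ₙ`. -/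
def Z (n : ℕ) (c : κ) : Submodule (A O) (Fin n → A O) := LinearMap.ker (cover n c)

theorem cover_apply (n : ℕ) (c : κ) (z : Fin n → A O) :
    cover n c z = ((fun i => IsLocalRing.residue O (c0 (z i)),
      (fun i => IsLocalRing.residue O (cX (z i))) +
        (jordan n c).mulVec (fun i => IsLocalRing.residue O (cY (z i)))) :
      (Fin n → κ) × (Fin n → κ)) := by
  have h (i : Fin n) : z i • u n c i =
      ((Pi.single i (IsLocalRing.residue O (c0 (z i))),
        Pi.single i (IsLocalRing.residue O (cX (z i))) +
        (jordan n c).mulVec (Pi.single i (IsLocalRing.residue O (cY (z i))))) :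
      (Fin n → κ) × (Fin n → κ)) := by
    refine Prod.ext ?_ ?_
    · change IsLocalRing.residue O (c0 (z i)) • Pi.single i (1 : κ) = _
      rw [← Pi.single_smul]; simp
    · change IsLocalRing.residue O (c0 (z i)) • (0 : Fin n → κ) +
        IsLocalRing.residue O (cX (z i)) • Pi.single i (1 : κ) +
        IsLocalRing.residue O (cY (z i)) • (jordan n c).mulVec (Pi.single i (1 : κ)) = _
      rw [← Matrix.mulVec_smul, ← Pi.single_smul, ← Pi.single_smul]; simp
  have h2 (f : Fin n → κ) : f = ∑ i, Pi.single i (f i) := by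
    simpa using (Finset.univ_sum_single f).symm
  rw [cover, Fintype.linearCombination_apply, Finset.sum_congr rfl (fun i _ => h i)]
  refine (Prod.ext ?_ ?_ :
    (∑ i, ((Pi.single i (IsLocalRing.residue O (c0 (z i))),
        Pi.single i (IsLocalRing.residue O (cX (z i))) +
        (jordan n c).mulVec (Pi.single i (IsLocalRing.residue O (cY (z i))))) :
      (Fin n → κ) × (Fin n → κ))) = _)
  · rw [Prod.fst_sum]
    exact (h2 _).symm
  · rw [Prod.snd_sum, Finset.sum_add_distrib, ← Matrix.mulVec_sum]
    dsimp only
    rw [← h2 (fun i => IsLocalRing.residue O (cX (z i))),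
      ← h2 (fun i => IsLocalRing.residue O (cY (z i)))]

theorem mem_Z (n : ℕ) (c : κ) (z : Fin n → A O) : z ∈ Z n c ↔
    (∀ i, IsLocalRing.residue O (c0 (z i)) = 0) ∧
      (fun i => IsLocalRing.residue O (cX (z i))) +
        (jordan n c).mulVec (fun i => IsLocalRing.residue O (cY (z i))) = 0 := by
  rw [Z, LinearMap.mem_ker, cover_apply]
  refine (Prod.ext_iff (α := Fin n → κ) (β := Fin n → κ) (y := 0)).trans ?_
  simp [funext_iff]

/-- The standard basis vector `eᵢ` of `Aⁿ`. -/
def e {n : ℕ} (i : Fin n) : Fin n → A O := Pi.single i 1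

/-- The predecessor `eᵢ₋₁` of `eᵢ` in the standard basis of `Aⁿ`, and `0` if `eᵢ` is the first. -/
def ePred {n : ℕ} (i : Fin n) : Fin n → A O := fun j => if j.val + 1 = i.val then 1 else 0

/-- The element `a_{k,1} = ε e_k` of `Zₙᶜ`, where `ε` is a non-unit. -/
def a1 (n : ℕ) (c : κ) (ε : O) (hε : ¬ IsUnit ε) (k : Fin n) : Z n c :=
  ⟨ε • e k, by
    have h : IsLocalRing.residue O ε = 0 := by
      simpa [IsLocalRing.residue_eq_zero_iff] using hε
    have h1 (i : Fin n) : cX ((e k : Fin n → A O) i) = 0 := by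
      by_cases hi : i = k
      · subst hi; simp [e]
      · simp [e, hi]
    have h2 (i : Fin n) : cY ((e k : Fin n → A O) i) = 0 := by
      by_cases hi : i = k
      · subst hi; simp [e]
      · simp [e, hi]
    rw [mem_Z]
    refine ⟨fun i => by simp [h], ?_⟩
    simp only [Pi.smul_apply, cX_smul, cY_smul, h1, h2, mul_zero, map_zero]
    exact (congrArg _ (Matrix.mulVec_zero _)).trans (add_zero _)⟩

/-- The element `a_{k,3} = Y e_k - l X e_k - X e_{k-1}` of `Zₙᶜ`, where `l` is a lift of `c`. -/
def a3 (n : ℕ) (l : O) (k : Fin n) : Z n (IsLocalRing.residue O l) :=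
  ⟨y O • e k - (l • x O) • e k - x O • ePred k, by
    rw [mem_Z]
    have hY : (fun i => IsLocalRing.residue O
        (cY ((y O • e k - (l • x O) • e k - x O • ePred k : Fin n → A O) i))) =
        Pi.single k 1 := by
      funext i
      by_cases hi : i = k
      · subst hi; simp [e, ePred]
      · by_cases h : i.val + 1 = k.val <;> simp [e, ePred, hi, h]
    refine ⟨fun i => ?_, ?_⟩
    · by_cases hi : i = k
      · subst hi; simp [e, ePred]
      · by_cases h : i.val + 1 = k.val <;> simp [e, ePred, hi, h]
    · rw [hY]
      funext i
      by_cases hi : i = k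
      · subst hi; simp [e, ePred, jordan]
      · by_cases h : i.val + 1 = k.val <;> simp [e, ePred, hi, h, jordan]⟩

/-- The element `a_{k,4} = XY e_k` of `Zₙᶜ`. -/
def a4 (n : ℕ) (c : κ) (k : Fin n) : Z n c :=
  ⟨(x O * y O) • e k, by
    rw [mem_Z]
    have hX : (fun i => IsLocalRing.residue O
        (cX (((x O * y O) • e k : Fin n → A O) i))) = 0 := by
      funext i; simp
    have hY : (fun i => IsLocalRing.residue O
        (cY (((x O * y O) • e k : Fin n → A O) i))) = 0 := by
      funext i; simp
    refine ⟨fun i => by simp, ?_⟩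
    rw [hX, hY]; simp⟩

/-- The map `π : A²ⁿ → Zₙᶜ` for a lift `l` of `c`. The standard basis of `A²ⁿ` is indexed by pairs:
`(k, 0)` stands for the index `2k - 1` and is sent to `a_{k,1}`, and `(k, 1)` stands for the index
`2k` and is sent to `a_{k,3}` (for `k = 1, …, n`). -/
def piMap (n : ℕ) (l ε : O) (hε : ¬ IsUnit ε) :
    (Fin n × Fin 2 → A O) →ₗ[A O] Z n (IsLocalRing.residue O l) :=
  Fintype.linearCombination (A O)
    (fun p => if p.2 = 0 then a1 n (IsLocalRing.residue O l) ε hε p.1 else a3 n l p.1)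

end Heller

/-! ### The endomorphism `Φ` -/

section Phi

variable {O : Type u} [CommRing O] [IsDomain O] [IsDiscreteValuationRing O]

local notation "κ" => IsLocalRing.ResidueField O

theorem exists_c0_eq (n : ℕ) (c : κ) (ε : O) (hε : Irreducible ε) (z : Z n c) (i : Fin n) :
    ∃ t : O, c0 (z.1 i) = ε * t := by
  have h := ((mem_Z n c z.1).1 z.2).1 i
  rw [IsLocalRing.residue_eq_zero_iff, hε.maximalIdeal_eq, Ideal.mem_span_singleton] at h
  exact h

/-- The coefficient of `a_{i,1} = ε eᵢ` in an element `z` of `Zₙᶜ`: the constant coefficient of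
the `i`-th coordinate of `z`, divided by `ε`. -/
def a1Coeff (n : ℕ) (c : κ) (ε : O) (hε : Irreducible ε) (i : Fin n) (z : Z n c) : O :=
  (exists_c0_eq n c ε hε z i).choose

theorem a1Coeff_spec (n : ℕ) (c : κ) (ε : O) (hε : Irreducible ε) (i : Fin n) (z : Z n c) :
    ε * a1Coeff n c ε hε i z = c0 (z.1 i) :=
  (exists_c0_eq n c ε hε z i).choose_spec.symm

/-- The endomorphism `Φ` of `Zₙᶜ`, `z ↦ (coefficient of a_{n,1} in z) • a_{n,4}`. -/
def Phi (n : ℕ) (hn : 0 < n) (c : κ) (ε : O) (hε : Irreducible ε) : Z n c →ₗ[A O] Z n c where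
  toFun z := a1Coeff n c ε hε ⟨n - 1, by omega⟩ z • a4 n c ⟨n - 1, by omega⟩
  map_add' z w := by
    rw [← add_smul]
    congr 1
    apply mul_left_cancel₀ hε.ne_zero
    rw [mul_add]
    simp only [a1Coeff_spec]
    simp
  map_smul' a z := by
    have h : a1Coeff n c ε hε ⟨n - 1, by omega⟩ (a • z) =
        c0 a * a1Coeff n c ε hε ⟨n - 1, by omega⟩ z := by
      apply mul_left_cancel₀ hε.ne_zero
      rw [mul_left_comm]
      simp only [a1Coeff_spec]
      simp
    have h2 (k : Fin n) : a • a4 n c k = c0 a • a4 n c k := by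
      apply Subtype.ext
      change a • ((x O * y O) • (e k : Fin n → A O)) = c0 a • ((x O * y O) • (e k : Fin n → A O))
      rw [smul_smul, mul_x_mul_y, smul_assoc]
    rw [h, RingHom.id_apply, smul_comm, h2, smul_smul, mul_comm]

/-- `Φ` sends `a_{n,1}` to `a_{n,4}` and the other `a_{k,1}` to `0`. -/
theorem Phi_a1 (n : ℕ) (hn : 0 < n) (c : κ) (ε : O) (hε : Irreducible ε) (k : Fin n) :
    Phi n hn c ε hε (a1 n c ε hε.not_isUnit k) =
      if k = ⟨n - 1, by omega⟩ then a4 n c ⟨n - 1, by omega⟩ else 0 := by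
  change a1Coeff n c ε hε ⟨n - 1, by omega⟩ (a1 n c ε hε.not_isUnit k) •
    a4 n c ⟨n - 1, by omega⟩ = _
  have h : a1Coeff n c ε hε ⟨n - 1, by omega⟩ (a1 n c ε hε.not_isUnit k) =
      if k = ⟨n - 1, by omega⟩ then 1 else 0 := by
    apply mul_left_cancel₀ hε.ne_zero
    rw [a1Coeff_spec]
    change c0 (ε • (e k : Fin n → A O) ⟨n - 1, by omega⟩) = _
    by_cases hk : k = ⟨n - 1, by omega⟩
    · subst hk; simp [e]
    · simp [e, hk, Ne.symm hk]
  rw [h]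
  split_ifs <;> simp

/-- The lattice `Eₙ = {(x, y) ∈ A²ⁿ ⊕ Zₙᶜ | π x = Φ y}`, for a lift `l` of `c`. -/
def E (n : ℕ) (hn : 0 < n) (l ε : O) (hε : Irreducible ε) :
    Submodule (A O) ((Fin n × Fin 2 → A O) × Z n (IsLocalRing.residue O l)) :=
  pullback (piMap n l ε hε.not_isUnit) (Phi n hn (IsLocalRing.residue O l) ε hε)

/-- The map `Eₙ → Zₙᶜ`, `(x, y) ↦ y`. -/
def EtoZ (n : ℕ) (hn : 0 < n) (l ε : O) (hε : Irreducible ε) :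
    E n hn l ε hε →ₗ[A O] Z n (IsLocalRing.residue O l) :=
  pullbackSnd _ _

/-- The map `K → Eₙ`, `x ↦ (ι x, 0)`, induced by a map `ι : K → A²ⁿ` with `π ∘ ι = 0`. -/
def toE (n : ℕ) (hn : 0 < n) (l ε : O) (hε : Irreducible ε)
    {K : Type u} [AddCommGroup K] [Module (A O) K] (ι : K →ₗ[A O] (Fin n × Fin 2 → A O))
    (h : piMap n l ε hε.not_isUnit ∘ₗ ι = 0) : K →ₗ[A O] E n hn l ε hε :=
  pullbackLift _ _ ι h

end Phi

end

end SymKron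

/-! A short exact sequence of lattices whose ends have local endomorphism rings is almost split once
it does not split and every non-retraction `h` into its right term lifts. For the pullback along
`Φ`, a lift of `h` is the same as a factorization of `Φ ∘ h` through `π`. So two facts are needed:
`Φ` itself does not factor through `π`, and `Φ ∘ h` does for every non-retraction `h`.

Both rest on the relation `ε a_{k,3} = (Y - λX) a_{k,1} - X a_{k-1,1}`. It shows that homomorphisms
from `Z` to a lattice `W` correspond to tuples `w` in `Wⁿ` (the images of the `a_{k,1}`) with `D w`
in `ε Wⁿ`, where `D` is `shiftMap`. An endomorphism `s` of `Z` thus has a matrix over `O`, the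
`a_{j,1}`-coefficients of the `s(a_{k,1})`. Modulo `ε` it commutes with a nilpotent Jordan block, so
it is upper triangular Toeplitz, and `s` is bijective when the diagonal is a unit
(`bijective_of_not_dvd`). Hence `End Z` is local.

If `Φ = π ∘ ρ`, the sum of the `j`-th coordinates of the `Φ(a_{j,1})` is divisible by `ε`; but this
trace is `XY` (`piMap_comp_ne_Phi`).

For a non-retraction `h`, let `φ(w)` be the `a_{n,1}`-coefficient of `h(wₙ)`. When `D w` is in `ε
Wⁿ`, the tuple `w` gives `ψ : Z → W`, and `h ∘ ψ` is not bijective, so `ε` divides `φ(w)`. By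
duality over the residue field `φ = q ∘ D + ε p`, and the symmetrizing form of `A` turns `p` and `q`
into the components of the required `ρ` (`exists_piMap_comp_eq`). -/

namespace SymKron

/-! ### A criterion for almost split sequences of lattices -/

section AlmostSplit

variable {O : Type u} {R : Type u} [CommRing O] [CommRing R] [Algebra O R]
variable {L M N : Type u} [AddCommGroup L] [AddCommGroup M] [AddCommGroup N]
variable [Module R L] [Module R M] [Module R N]

/-- The endomorphism ring of `L` is local: for each endomorphism `s`, one of `s` and `1 - s` is
bijective. -/
def HasLocalEnd (R L : Type u) [CommRing R] [AddCommGroup L] [Module R L] : Prop :=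
  ∀ s : L →ₗ[R] L, Function.Bijective s ∨
    Function.Bijective ((LinearMap.id : L →ₗ[R] L) - s)

theorem HasLocalEnd.isIndecomposable [Nontrivial L] (h : HasLocalEnd R L) :
    IsIndecomposable R L := by
  refine ⟨inferInstance, fun P Q hPQ => ?_⟩
  rcases h (P.projection Q hPQ) with h | h
  · right
    have : LinearMap.ker (P.projection Q hPQ) = ⊥ := LinearMap.ker_eq_bot.2 h.1
    rwa [Submodule.ker_projection] at this
  · left
    rw [eq_bot_iff]
    intro p hp
    apply h.1
    simp [Submodule.projection_apply_left hPQ ⟨p, hp⟩]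

theorem isSection_of_bijective_comp {f : L →ₗ[R] M} {g : M →ₗ[R] N}
    (h : Function.Bijective (g ∘ₗ f)) : IsSection f := by
  refine ⟨(LinearEquiv.ofBijective _ h).symm.toLinearMap ∘ₗ g, ?_⟩
  ext x
  exact (LinearEquiv.ofBijective _ h).symm_apply_apply x

theorem isRetraction_of_bijective_comp {f : L →ₗ[R] M} {g : M →ₗ[R] N}
    (h : Function.Bijective (g ∘ₗ f)) : IsRetraction g := by
  refine ⟨f ∘ₗ (LinearEquiv.ofBijective _ h).symm.toLinearMap, ?_⟩
  ext x
  exact (LinearEquiv.ofBijective _ h).apply_symm_apply x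

/-- In a short exact sequence, the map on the right is a retraction if the map on the left is a
section. -/
theorem isRetraction_of_isSection {f : L →ₗ[R] M} {g : M →ₗ[R] N}
    (hfg : Function.Exact f g) (hg : Function.Surjective g) (h : IsSection f) :
    IsRetraction g := by
  obtain ⟨r, hr⟩ := h
  have hr' (x : L) : r (f x) = x := LinearMap.congr_fun hr x
  have hker : LinearMap.ker g ≤ LinearMap.ker (LinearMap.id - f ∘ₗ r) := by
    intro m hm
    obtain ⟨x, rfl⟩ := (hfg m).1 hm
    simp [hr']
  refine ⟨(LinearMap.ker g).liftQ _ hker ∘ₗ (g.quotKerEquivOfSurjective hg).symm.toLinearMap, ?_⟩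
  ext z
  obtain ⟨m, rfl⟩ := hg z
  have : (g.quotKerEquivOfSurjective hg).symm (g m) = (LinearMap.ker g).mkQ m := by
    rw [LinearEquiv.symm_apply_eq]; rfl
  simp [this, hfg.apply_apply_eq_zero]

/-- The short five lemma, for an endomorphism of a short exact sequence. -/
theorem bijective_of_exact {f : L →ₗ[R] M} {g : M →ₗ[R] N} (hf : Function.Injective f)
    (hfg : Function.Exact f g) (hg : Function.Surjective g) {s : L →ₗ[R] L} {t : M →ₗ[R] M}
    {v : N →ₗ[R] N} (hs : Function.Bijective s) (hv : Function.Bijective v)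
    (hst : f ∘ₗ s = t ∘ₗ f) (htv : g ∘ₗ t = v ∘ₗ g) : Function.Bijective t := by
  have hst' (x : L) : f (s x) = t (f x) := LinearMap.congr_fun hst x
  have htv' (x : M) : g (t x) = v (g x) := LinearMap.congr_fun htv x
  constructor
  · rw [injective_iff_map_eq_zero]
    intro m hm
    have h1 : g m = 0 := by
      apply hv.1
      rw [← htv', hm, map_zero, map_zero]
    obtain ⟨x, rfl⟩ := (hfg m).1 h1
    rw [← hst'] at hm
    have h2 : s x = 0 := hf (by rw [hm, map_zero])
    have h3 : x = 0 := hs.1 (by rw [h2, map_zero])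
    rw [h3, map_zero]
  · intro m
    obtain ⟨z, hz⟩ := hv.2 (g m)
    obtain ⟨m', rfl⟩ := hg z
    rw [← htv'] at hz
    obtain ⟨x, hx⟩ := (hfg (m - t m')).1 (by rw [map_sub, hz, sub_self])
    obtain ⟨x', rfl⟩ := hs.2 x
    refine ⟨f x' + m', ?_⟩
    rw [map_add, ← hst', hx, sub_add_cancel]

theorem exists_comp_eq_of_comp_eq_zero {f : L →ₗ[R] M} {g : M →ₗ[R] N}
    (hf : Function.Injective f) (hfg : Function.Exact f g) {K : Type u} [AddCommGroup K]
    [Module R K] (t : K →ₗ[R] M) (ht : g ∘ₗ t = 0) : ∃ r : K →ₗ[R] L, f ∘ₗ r = t := by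
  have h (x : K) : t x ∈ LinearMap.range f := (hfg _).1 (LinearMap.congr_fun ht x)
  refine ⟨(LinearEquiv.ofInjective f hf).symm.toLinearMap ∘ₗ t.codRestrict _ h, ?_⟩
  ext x
  exact congrArg Subtype.val
    ((LinearEquiv.ofInjective f hf).apply_symm_apply (t.codRestrict _ h x))

/-- Right minimality: an endomorphism of the middle term over the right term is bijective. -/
theorem bijective_of_comp_eq {f : L →ₗ[R] M} {g : M →ₗ[R] N} (hf : Function.Injective f)
    (hfg : Function.Exact f g) (hg : Function.Surjective g) (hL : HasLocalEnd R L)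
    (hns : ¬ IsRetraction g) {s : L →ₗ[R] L} {t : M →ₗ[R] M} (hst : f ∘ₗ s = t ∘ₗ f)
    (ht : g ∘ₗ t = g) : Function.Bijective s ∧ Function.Bijective t := by
  have hs : Function.Bijective s := by
    -- `1 - t` lands in the kernel of `g`, so it is `f ∘ r` with `r ∘ f = 1 - s`. Were `1 - s`
    -- bijective, `f` would be a section and the sequence would split.
    refine (hL s).resolve_right fun h => hns (isRetraction_of_isSection hfg hg ?_)
    obtain ⟨r, hr⟩ := exists_comp_eq_of_comp_eq_zero hf hfg (LinearMap.id - t)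
      (by rw [LinearMap.comp_sub, ht, LinearMap.comp_id, sub_self])
    have : r ∘ₗ f = LinearMap.id - s := by
      ext x
      apply hf
      have h1 := LinearMap.congr_fun hr (f x)
      have h2 := LinearMap.congr_fun hst x
      simp only [LinearMap.comp_apply, LinearMap.sub_apply, LinearMap.id_apply] at h1 h2 ⊢
      rw [h1, map_sub, h2]
    exact isSection_of_bijective_comp (g := r) (this ▸ h)
  exact ⟨hs, bijective_of_exact hf hfg hg hs Function.bijective_id hst (v := LinearMap.id)
    (by rw [ht, LinearMap.id_comp])⟩

/-- Left minimality: an endomorphism of the middle term under the left term is bijective. -/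
theorem bijective_of_comp_eq' {f : L →ₗ[R] M} {g : M →ₗ[R] N} (hf : Function.Injective f)
    (hfg : Function.Exact f g) (hg : Function.Surjective g) (hN : HasLocalEnd R N)
    (hns : ¬ IsRetraction g) {t : M →ₗ[R] M} (ht : t ∘ₗ f = f) : Function.Bijective t := by
  have hker : LinearMap.ker g ≤ LinearMap.ker (LinearMap.id - t) := by
    intro m hm
    obtain ⟨x, rfl⟩ := (hfg m).1 hm
    have := LinearMap.congr_fun ht x
    simp only [LinearMap.comp_apply] at this
    simp [this]
  let r : N →ₗ[R] M :=
    (LinearMap.ker g).liftQ _ hker ∘ₗ (g.quotKerEquivOfSurjective hg).symm.toLinearMap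
  have hr (m : M) : r (g m) = m - t m := by
    have : (g.quotKerEquivOfSurjective hg).symm (g m) = (LinearMap.ker g).mkQ m := by
      rw [LinearEquiv.symm_apply_eq]; rfl
    simp [r, this]
  -- `1 - t` kills `f`, hence is `r ∘ g`, and `t` induces `1 - g ∘ r` on `N`. Bijectivity of `g ∘ r`
  -- would make `g` a retraction.
  have hv : Function.Bijective ((LinearMap.id : N →ₗ[R] N) - g ∘ₗ r) :=
    (hN (g ∘ₗ r)).resolve_left fun h => hns (isRetraction_of_bijective_comp h)
  refine bijective_of_exact hf hfg hg Function.bijective_id hv (s := LinearMap.id)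
    (by rw [ht, LinearMap.comp_id]) ?_
  ext m
  simp [hr]

theorem IsLattice.eq_zero_of_smul_eq_zero [IsDomain O] {W : Type u} [AddCommGroup W] [Module O W]
    (h : IsLattice O W) {r : O} (hr : r ≠ 0) {w : W} (hw : r • w = 0) : w = 0 := by
  have := h.1
  exact (smul_eq_zero.1 hw).resolve_left hr

theorem IsLattice.prod {M N : Type u} [AddCommGroup M] [AddCommGroup N] [Module O M] [Module O N]
    (hM : IsLattice O M) (hN : IsLattice O N) : IsLattice O (M × N) := by
  have := hM.1
  have := hM.2
  have := hN.1
  have := hN.2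
  exact ⟨inferInstance, inferInstance⟩

variable [IsDomain O] [IsPrincipalIdealRing O]

theorem isLattice_of_finite_of_torsionFree {W : Type u} [AddCommGroup W] [Module O W]
    [Module.Finite O W] (h : ∀ (r : O) (w : W), r ≠ 0 → r • w = 0 → w = 0) : IsLattice O W := by
  have : Module.IsTorsionFree O W := by
    refine Module.isTorsionFree_iff_smul_eq_zero.2 fun r w hrw => ?_
    by_cases hr : r = 0
    · exact Or.inl hr
    · exact Or.inr (h r w hr hrw)
  exact ⟨inferInstance, inferInstance⟩

variable [Module O M] [Module O N] [IsScalarTower O R M] [IsScalarTower O R N]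

theorem IsLattice.submodule (hM : IsLattice O M) (S : Submodule R M) :
    IsLattice O S := by
  have := hM.1
  have := hM.2
  have h : IsLattice O (S.restrictScalars O) := ⟨inferInstance, inferInstance⟩
  exact h

/-- Passes from the lifting property of `g` to the dual extension property of `f`. The sequence is
pushed out along `h`, and the lifting property is applied to the new map onto `N`. -/
theorem exists_extension_of_not_isSection {f : L →ₗ[R] M} {g : M →ₗ[R] N} (hM : IsLattice O M)
    (hNl : IsLattice O N) (hf : Function.Injective f) (hfg : Function.Exact f g)
    (hg : Function.Surjective g) (hL : HasLocalEnd R L) (hns : ¬ IsRetraction g)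
    (hlift : ∀ (W : Type u) [AddCommGroup W] [Module O W] [Module R W] [IsScalarTower O R W],
      IsLattice O W → ∀ h : W →ₗ[R] N, ¬ IsRetraction h → ∃ k : W →ₗ[R] M, g ∘ₗ k = h)
    {W : Type u} [AddCommGroup W] [Module O W] [Module R W] [IsScalarTower O R W]
    (hW : IsLattice O W) (h : L →ₗ[R] W) (hh : ¬ IsSection h) :
    ∃ k : M →ₗ[R] W, k ∘ₗ f = h := by
  let S : Submodule R (W × M) := LinearMap.range (h.prod (-f))
  have hgS : S ≤ LinearMap.ker (g ∘ₗ LinearMap.snd R W M) := by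
    rintro _ ⟨x, rfl⟩
    simp [hfg.apply_apply_eq_zero]
  let g' : ((W × M) ⧸ S) →ₗ[R] N := S.liftQ _ hgS
  let i : W →ₗ[R] (W × M) ⧸ S := S.mkQ ∘ₗ LinearMap.inl R W M
  let j : M →ₗ[R] (W × M) ⧸ S := S.mkQ ∘ₗ LinearMap.inr R W M
  have hij : i ∘ₗ h = j ∘ₗ f := by
    ext x
    simp only [i, j, LinearMap.comp_apply, Submodule.mkQ_apply]
    rw [Submodule.Quotient.eq]
    exact ⟨x, by simp⟩
  have hgj : g' ∘ₗ j = g := by ext; simp [g', j]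
  have hgi : g' ∘ₗ i = 0 := by ext; simp [g', i]
  have hi : Function.Injective i := by
    rw [injective_iff_map_eq_zero]
    intro w hw
    simp only [i, LinearMap.comp_apply, Submodule.mkQ_apply] at hw
    rw [Submodule.Quotient.mk_eq_zero] at hw
    obtain ⟨x, hx⟩ := hw
    have h1 : x = 0 := hf (by simpa using congrArg Prod.snd hx)
    subst h1
    simpa using (congrArg Prod.fst hx).symm
  have hex : Function.Exact i g' := by
    intro v
    constructor
    · obtain ⟨⟨w, m⟩, rfl⟩ := S.mkQ_surjective v
      intro hv
      obtain ⟨x, rfl⟩ := (hfg m).1 (by simpa [g'] using hv)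
      refine ⟨w + h x, ?_⟩
      simp only [i, LinearMap.comp_apply, Submodule.mkQ_apply]
      rw [Submodule.Quotient.eq]
      exact ⟨x, by simp⟩
    · rintro ⟨w, rfl⟩
      exact LinearMap.congr_fun hgi w
  -- The pushout is an extension of the lattice `N` by the lattice `W`, hence finite and
  -- torsion-free over a principal ideal domain.
  have hV : IsLattice O ((W × M) ⧸ S) := by
    have : Module.Finite O (W × M) := (hW.prod hM).2
    have : Module.Finite O ((W × M) ⧸ S) :=
      Module.Finite.of_surjective (S.mkQ.restrictScalars O) S.mkQ_surjective
    refine isLattice_of_finite_of_torsionFree fun r v hr hv => ?_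
    have h1 : g' v = 0 := hNl.eq_zero_of_smul_eq_zero hr (by
      rw [← LinearMap.map_smul_of_tower, hv, map_zero])
    obtain ⟨w, rfl⟩ := (hex v).1 h1
    have h2 : r • w = 0 := hi (by
      rw [LinearMap.map_smul_of_tower, hv, map_zero])
    rw [hW.eq_zero_of_smul_eq_zero hr h2, map_zero]
  -- If the pushed out sequence splits, a retraction of `i` composed with `j` extends `h`. Otherwise
  -- `g'` lifts to some `k`, and `k ∘ j` is an endomorphism of `M` over `N` that induces `r ∘ h` on
  -- `L`; right minimality makes `r ∘ h` bijective, so `h` would be a section.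
  by_cases hr : IsRetraction g'
  · obtain ⟨σ, hσ⟩ := hr
    have h1 : g' ∘ₗ (LinearMap.id - σ ∘ₗ g') = 0 := by
      rw [LinearMap.comp_sub, ← LinearMap.comp_assoc, hσ, LinearMap.id_comp, LinearMap.comp_id,
        sub_self]
    obtain ⟨r, hr⟩ := exists_comp_eq_of_comp_eq_zero hi hex _ h1
    refine ⟨r ∘ₗ j, ?_⟩
    ext x
    apply hi
    have h2 := LinearMap.congr_fun hr (j (f x))
    have h3 := LinearMap.congr_fun hij x
    have h4 : g' (j (f x)) = 0 :=
      (LinearMap.congr_fun hgj (f x)).trans (hfg.apply_apply_eq_zero x)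
    simp only [LinearMap.comp_apply, LinearMap.sub_apply, LinearMap.id_apply] at h2 h3 ⊢
    rw [h2, h3, h4, map_zero, sub_zero]
  · obtain ⟨k, hk⟩ := hlift _ hV g' hr
    have h1 : g ∘ₗ (k ∘ₗ i) = 0 := by rw [← LinearMap.comp_assoc, hk, hgi]
    obtain ⟨r, hr⟩ := exists_comp_eq_of_comp_eq_zero hf hfg _ h1
    have h2 : f ∘ₗ (r ∘ₗ h) = (k ∘ₗ j) ∘ₗ f := by
      rw [← LinearMap.comp_assoc, hr, LinearMap.comp_assoc, hij]
      rfl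
    have h3 := bijective_of_comp_eq hf hfg hg hL hns h2
      (by rw [← LinearMap.comp_assoc, hk, hgj])
    exact absurd (isSection_of_bijective_comp h3.1) hh

variable [Module O L] [IsScalarTower O R L]

/-- A short exact sequence of lattices whose end terms have local endomorphism rings is almost
split if it does not split and each non-retraction to its right term lifts to the middle term. -/
theorem isAlmostSplit_of_lift {f : L →ₗ[R] M} {g : M →ₗ[R] N} (hLl : IsLattice O L)
    (hM : IsLattice O M) (hNl : IsLattice O N) [Nontrivial L] [Nontrivial N]
    (hf : Function.Injective f) (hfg : Function.Exact f g) (hg : Function.Surjective g)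
    (hL : HasLocalEnd R L) (hN : HasLocalEnd R N) (hns : ¬ IsRetraction g)
    (hlift : ∀ (W : Type u) [AddCommGroup W] [Module O W] [Module R W] [IsScalarTower O R W],
      IsLattice O W → ∀ h : W →ₗ[R] N, ¬ IsRetraction h → ∃ k : W →ₗ[R] M, g ∘ₗ k = h) :
    IsAlmostSplit O R L M N f g where
  lattice_left := hLl
  lattice_middle := hM
  lattice_right := hNl
  injective := hf
  exact := hfg
  surjective := hg
  irreducible_left := by
    refine ⟨fun h => hns (isRetraction_of_isSection hfg hg h), ?_, ?_⟩
    · rintro ⟨s, hs⟩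
      obtain ⟨z, hz⟩ := exists_ne (0 : N)
      obtain ⟨m, rfl⟩ := hg z
      apply hz
      rw [← show f (s m) = m from LinearMap.congr_fun hs m, hfg.apply_apply_eq_zero]
    · intro W _ _ _ _ hW f₁ f₂ hff
      by_contra! hc
      -- With `f₁ = k ∘ f`, the endomorphism `f₂ ∘ k` fixes `f`, so left minimality makes `f₂` a
      -- retraction.
      obtain ⟨k, hk⟩ := exists_extension_of_not_isSection hM hNl hf hfg hg hL hns hlift hW f₁ hc.1
      apply hc.2
      apply isRetraction_of_bijective_comp (f := k)
      apply bijective_of_comp_eq' hf hfg hg hN hns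
      rw [LinearMap.comp_assoc, hk, ← hff]
  irreducible_right := by
    refine ⟨?_, hns, ?_⟩
    · rintro ⟨r, hr⟩
      obtain ⟨z, hz⟩ := exists_ne (0 : L)
      apply hz
      apply hf
      have : r (g (f z)) = f z := LinearMap.congr_fun hr (f z)
      rw [← this, hfg.apply_apply_eq_zero, map_zero, map_zero]
    · intro W _ _ _ _ hW f₁ f₂ hff
      by_contra! hc
      obtain ⟨k, hk⟩ := hlift W hW f₂ hc.2
      apply hc.1
      apply isSection_of_bijective_comp (g := k)
      have ht : g ∘ₗ (k ∘ₗ f₁) = g := by rw [← LinearMap.comp_assoc, hk, ← hff]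
      have h0 : g ∘ₗ ((k ∘ₗ f₁) ∘ₗ f) = 0 := by
        rw [← LinearMap.comp_assoc, ht]
        exact hfg.linearMap_comp_eq_zero
      obtain ⟨s, hs⟩ := exists_comp_eq_of_comp_eq_zero hf hfg _ h0
      exact (bijective_of_comp_eq hf hfg hg hL hns hs ht).2
  indecomposable_left := hL.isIndecomposable
  indecomposable_right := hN.isIndecomposable

end AlmostSplit
-- The basis `1, X, Y, XY` of `A`, Nakayama's lemma and the symmetrizing form
section Coefficients

variable {O : Type u} [CommRing O]

/-- The coefficient of `XY`. -/
noncomputable def cXY (a : A O) : O := (coord O a).snd.snd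

@[simp] theorem cXY_zero : cXY (0 : A O) = 0 := by simp [cXY]
@[simp] theorem cXY_one : cXY (1 : A O) = 0 := by simp [cXY]
@[simp] theorem cXY_x : cXY (x O) = 0 := by simp [cXY, coord_x]
@[simp] theorem cXY_y : cXY (y O) = 0 := by simp [cXY, coord_y]
@[simp] theorem cXY_add (a b : A O) : cXY (a + b) = cXY a + cXY b := by simp [cXY]
@[simp] theorem cXY_sub (a b : A O) : cXY (a - b) = cXY a - cXY b := by simp [cXY]
@[simp] theorem cXY_neg (a : A O) : cXY (-a) = -cXY a := by simp [cXY]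
@[simp] theorem cXY_smul (r : O) (b : A O) : cXY (r • b) = r * cXY b := by simp [cXY]
@[simp] theorem cXY_mul (a b : A O) :
    cXY (a * b) = c0 a * cXY b + cX a * cY b + cY a * cX b + cXY a * c0 b := by
  simp [c0, cX, cY, cXY]
  ring

/-- The coefficient of `1` as a ring homomorphism. -/
noncomputable def c0Hom (O : Type u) [CommRing O] : A O →+* O where
  toFun := c0
  map_one' := c0_one
  map_mul' := c0_mul
  map_zero' := c0_zero
  map_add' := c0_add

/-- The coefficient of `XY` as an additive homomorphism. -/
noncomputable def cXYHom (O : Type u) [CommRing O] : A O →+ O where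
  toFun := cXY
  map_zero' := cXY_zero
  map_add' := cXY_add

theorem cXY_sum {ι : Type*} (s : Finset ι) (f : ι → A O) :
    cXY (∑ i ∈ s, f i) = ∑ i ∈ s, cXY (f i) := map_sum (cXYHom O) f s

theorem span_basis_mul_x (r₀ r₁ r₂ r₃ : O) :
    (r₀ • 1 + r₁ • x O + r₂ • y O + r₃ • (x O * y O)) * x O =
      r₀ • x O + r₂ • (x O * y O) := by
  simp only [add_mul, smul_mul_assoc, one_mul, x_mul_x, mul_comm (y O) (x O),
    mul_right_comm (x O) (y O) (x O), zero_mul, smul_zero, add_zero]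

theorem span_basis_mul_y (r₀ r₁ r₂ r₃ : O) :
    (r₀ • 1 + r₁ • x O + r₂ • y O + r₃ • (x O * y O)) * y O =
      r₀ • y O + r₁ • (x O * y O) := by
  simp only [add_mul, smul_mul_assoc, one_mul, y_mul_y, mul_assoc, mul_zero, smul_zero, add_zero]

/-- The spanning half of the statement that `1, X, Y, XY` is a basis; the coefficient maps supply
independence. -/
theorem eq_sum_coeff (a : A O) :
    a = c0 a • 1 + cX a • x O + cY a • y O + cXY a • (x O * y O) := by
  obtain ⟨p, rfl⟩ := Ideal.Quotient.mk_surjective a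
  induction p using MvPolynomial.induction_on with
  | C r =>
    have h : (Ideal.Quotient.mk _ (MvPolynomial.C r) : A O) = r • (1 : A O) :=
      (Algebra.algebraMap_eq_smul_one (A := A O) r)
    rw [h]; simp
  | add p q hp hq =>
    rw [map_add]
    nth_rewrite 1 [hp, hq]
    simp only [c0_add, cX_add, cY_add, cXY_add, add_smul]
    abel
  | mul_X p i hp =>
    rw [map_mul]
    generalize (Ideal.Quotient.mk _ p : A O) = a at hp
    fin_cases i
    · change a * x O = c0 (a * x O) • 1 + cX (a * x O) • x O + cY (a * x O) • y O +
        cXY (a * x O) • (x O * y O)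
      rw [hp, span_basis_mul_x]
      simp
    · change a * y O = c0 (a * y O) • 1 + cX (a * y O) • x O + cY (a * y O) • y O +
        cXY (a * y O) • (x O * y O)
      rw [hp, span_basis_mul_y]
      simp

theorem ext_coeff {a b : A O} (h0 : c0 a = c0 b) (hX : cX a = cX b) (hY : cY a = cY b)
    (hXY : cXY a = cXY b) : a = b := by
  rw [eq_sum_coeff a, eq_sum_coeff b, h0, hX, hY, hXY]

/-- The coefficients with respect to the basis `1, X, Y, XY`. -/
noncomputable def coeffEquiv (O : Type u) [CommRing O] : A O ≃ₗ[O] O × O × O × O where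
  toFun a := (c0 a, cX a, cY a, cXY a)
  invFun t := t.1 • 1 + t.2.1 • x O + t.2.2.1 • y O + t.2.2.2 • (x O * y O)
  map_add' a b := by simp
  map_smul' r a := by simp
  left_inv a := (eq_sum_coeff a).symm
  right_inv t := by simp

instance : Module.Free O (A O) := Module.Free.of_equiv (coeffEquiv O).symm

instance : Module.Finite O (A O) := Module.Finite.equiv (coeffEquiv O).symm

theorem c0_algebraMap (r : O) : c0 (algebraMap O (A O) r) = r := by
  simp [Algebra.algebraMap_eq_smul_one]

/-- An element without constant coefficient has cube zero, so `a` is a unit plus a nilpotent. -/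
theorem isUnit_of_isUnit_c0 {a : A O} (h : IsUnit (c0 a)) : IsUnit a := by
  have h1 : IsNilpotent (a - algebraMap O (A O) (c0 a)) :=
    ⟨3, by
      simp only [pow_succ, pow_zero, one_mul]
      apply ext_coeff <;> simp [Algebra.algebraMap_eq_smul_one]⟩
  have h2 := h1.isUnit_add_left_of_commute (h.map (algebraMap O (A O))) (Commute.all _ _)
  simpa using h2

variable (O) in
/-- The maximal ideal of `A`. -/
noncomputable def maxIdeal [IsLocalRing O] : Ideal (A O) :=
  (IsLocalRing.maximalIdeal O).comap (c0Hom O)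

theorem mem_maxIdeal [IsLocalRing O] {a : A O} :
    a ∈ maxIdeal O ↔ c0 a ∈ IsLocalRing.maximalIdeal O := Iff.rfl

/-- Nakayama's lemma: `maxIdeal` lies in the Jacobson radical because units of `A` are detected by
`c0`. -/
theorem eq_top_of_sup_maxIdeal_smul [IsLocalRing O] {M : Type*} [AddCommGroup M] [Module (A O) M]
    [Module.Finite (A O) M] {Q : Submodule (A O) M} (h : Q ⊔ maxIdeal O • ⊤ = ⊤) : Q = ⊤ := by
  rw [eq_top_iff]
  refine Submodule.le_of_le_smul_of_le_jacobson_bot (I := maxIdeal O) Module.Finite.fg_top ?_ h.ge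
  intro a ha
  rw [Ideal.mem_jacobson_bot]
  intro b
  apply isUnit_of_isUnit_c0
  rw [c0_add, c0_mul, c0_one]
  by_contra hu
  have h1 : c0 a * c0 b + 1 ∈ IsLocalRing.maximalIdeal O := hu
  rw [mem_maxIdeal] at ha
  have h2 := (Submodule.add_mem_iff_right _ (Ideal.mul_mem_right (c0 b) _ ha)).1 h1
  exact (Ideal.ne_top_iff_one _).1 (IsLocalRing.maximalIdeal.isMaximal O).ne_top h2

theorem smul_mem_maxIdeal_smul [IsLocalRing O] {M : Type*} [AddCommGroup M] [Module (A O) M]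
    [Module O M] [IsScalarTower O (A O) M] {r : O} (hr : r ∈ IsLocalRing.maximalIdeal O) (m : M) :
    r • m ∈ maxIdeal O • (⊤ : Submodule (A O) M) := by
  rw [← algebraMap_smul (A O) r m]
  exact Submodule.smul_mem_smul (by rwa [mem_maxIdeal, c0_algebraMap]) Submodule.mem_top

theorem smul_sub_smul_mem_maxIdeal_smul [IsLocalRing O] {M : Type*} [AddCommGroup M]
    [Module (A O) M] [Module O M] [IsScalarTower O (A O) M] {a : A O} {r : O} (h : c0 a = r)
    (m : M) : a • m - r • m ∈ maxIdeal O • (⊤ : Submodule (A O) M) := by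
  rw [← algebraMap_smul (A O) r m, ← sub_smul]
  refine Submodule.smul_mem_smul ?_ Submodule.mem_top
  rw [mem_maxIdeal, c0_sub, c0_algebraMap, h, sub_self]
  exact zero_mem _

theorem mem_maxIdeal_smul_of_forall [IsLocalRing O] {ι : Type*} [Fintype ι] [DecidableEq ι]
    {v : ι → A O} (h : ∀ i, v i ∈ maxIdeal O) :
    v ∈ maxIdeal O • (⊤ : Submodule (A O) (ι → A O)) := by
  rw [pi_eq_sum_univ' v]
  exact Submodule.sum_mem _ fun i _ => Submodule.smul_mem_smul (h i) Submodule.mem_top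

/-- The `A`-linear map to `A` whose coefficient of `XY` is a given functional: the isomorphism
`Hom_O(W, O) ≃ Hom_A(W, A)` coming from the symmetrizing form of `A`. -/
noncomputable def ofFunctional {W : Type*} [AddCommGroup W] [Module O W] [Module (A O) W]
    [IsScalarTower O (A O) W] (f : W →ₗ[O] O) : W →ₗ[A O] A O where
  -- For the form `cXY`, the basis dual to `1, X, Y, XY` is `XY, Y, X, 1`; each coefficient is `f`
  -- evaluated on the dual multiple of `w`.
  toFun w := f ((x O * y O) • w) • 1 + f (y O • w) • x O + f (x O • w) • y O +
    f w • (x O * y O)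
  map_add' v w := by
    simp only [smul_add, map_add, add_smul]
    abel
  map_smul' a w := by
    have key (b : A O) : f (b • a • w) = c0 (b * a) * f w + cX (b * a) * f (x O • w) +
        cY (b * a) * f (y O • w) + cXY (b * a) * f ((x O * y O) • w) := by
      rw [smul_smul]
      nth_rewrite 1 [eq_sum_coeff (b * a)]
      simp [add_smul]
      ring
    have key1 := key 1
    simp only [one_smul, one_mul] at key1
    simp only [key, key1, RingHom.id_apply, smul_eq_mul]
    apply ext_coeff <;> simp

@[simp] theorem cXY_ofFunctional {W : Type*} [AddCommGroup W] [Module O W] [Module (A O) W]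
    [IsScalarTower O (A O) W] (f : W →ₗ[O] O) (w : W) : cXY (ofFunctional f w) = f w := by
  simp [ofFunctional]

/-- Nondegeneracy of the form: the remaining coefficients of `f w` are `XY`-coefficients of `f` at
`X w`, `Y w` and `XY w`. -/
theorem linearMap_ext_cXY {W : Type*} [AddCommGroup W] [Module (A O) W] {f g : W →ₗ[A O] A O}
    (h : ∀ w, cXY (f w) = cXY (g w)) : f = g := by
  ext1 w
  have hx := h (x O • w)
  have hy := h (y O • w)
  have hxy := h ((x O * y O) • w)
  simp only [map_smul, smul_eq_mul] at hx hy hxy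
  apply ext_coeff
  · simpa using hxy
  · simpa using hy
  · simpa using hx
  · exact h w

end Coefficients

/-! ### Division by `ε` and duality modulo `ε` -/

section Divisibility

variable {O : Type u} [CommRing O] [IsDomain O]

/-- Torsion-freeness makes the quotients by `r` unique, and uniqueness makes them linear. -/
theorem exists_smul_eq {R V W : Type*} [CommRing R] [Algebra O R] [AddCommGroup V]
    [AddCommGroup W] [Module R V] [Module R W] [Module O W] [IsScalarTower O R W]
    [Module.IsTorsionFree O W] {r : O} (hr : r ≠ 0) (f : V →ₗ[R] W)
    (h : ∀ v, ∃ w, r • w = f v) : ∃ g : V →ₗ[R] W, ∀ v, r • g v = f v := by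
  choose g hg using h
  refine ⟨⟨⟨g, fun v w => ?_⟩, fun a v => ?_⟩, hg⟩
  · apply smul_right_injective W hr
    simp [smul_add, hg]
  · apply smul_right_injective W hr
    change r • g (a • v) = r • a • g v
    rw [hg, map_smul, ← algebraMap_smul R r (a • g v), smul_comm, algebraMap_smul, hg]

open IsLocalRing in
/-- A functional on `V` is, modulo `ε`, a functional on `V'` composed with `D : V → V'` if it
vanishes modulo `ε` where `D` vanishes modulo `ε`. -/
theorem exists_eq_comp_add_smul [IsDiscreteValuationRing O] {V V' : Type u} [AddCommGroup V]
    [AddCommGroup V'] [Module O V] [Module O V'] [Module.Projective O V'] {ε : O}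
    (hε : Irreducible ε) (D : V →ₗ[O] V') (φ : V →ₗ[O] O)
    (h : ∀ v v', D v = ε • v' → ε ∣ φ v) :
    ∃ (q : V' →ₗ[O] O) (p : V →ₗ[O] O), ∀ v, φ v = q (D v) + ε * p v := by
  have hs : Function.Surjective (algebraMap O (ResidueField O)) := residue_surjective
  have hm : maximalIdeal O = Ideal.span {ε} := hε.maximalIdeal_eq
  have h1 : (maximalIdeal O • ⊤ : Submodule O V) ≤
      Submodule.comap D (maximalIdeal O • ⊤ : Submodule O V') := by
    rw [Submodule.smul_le]
    intro r hr v _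
    rw [Submodule.mem_comap, map_smul]
    exact Submodule.smul_mem_smul hr Submodule.mem_top
  have h2 : (maximalIdeal O • ⊤ : Submodule O V) ≤
      LinearMap.ker ((Algebra.linearMap O (ResidueField O)) ∘ₗ φ) := by
    rw [Submodule.smul_le]
    intro r hr v _
    have : residue O r = 0 := (residue_eq_zero_iff r).2 hr
    change residue O (φ (r • v)) = 0
    rw [map_smul, smul_eq_mul, map_mul, this, zero_mul]
  let _ (U : Type _) [AddCommGroup U] [Module O U] :
      Module (ResidueField O) (U ⧸ (maximalIdeal O • ⊤ : Submodule O U)) :=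
    inferInstanceAs (Module (O ⧸ maximalIdeal O) _)
  have (U : Type _) [AddCommGroup U] [Module O U] :
      IsScalarTower O (ResidueField O) (U ⧸ (maximalIdeal O • ⊤ : Submodule O U)) :=
    inferInstanceAs (IsScalarTower O (O ⧸ maximalIdeal O) _)
  let D' := LinearMap.extendScalarsOfSurjective hs (Submodule.mapQ _ _ D h1)
  let φ' := LinearMap.extendScalarsOfSurjective hs (Submodule.liftQ _ _ h2)
  -- Over the residue field, a functional that vanishes on the kernel of `D'` factors through `D'`.
  have h3 : φ' ∈ LinearMap.range D'.dualMap := by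
    rw [LinearMap.range_dualMap_eq_dualAnnihilator_ker, Submodule.mem_dualAnnihilator]
    intro w hw
    obtain ⟨v, rfl⟩ := Submodule.mkQ_surjective _ w
    have h4 : (Submodule.Quotient.mk (D v) : V' ⧸ (maximalIdeal O • ⊤ : Submodule O V')) = 0 := hw
    rw [Submodule.Quotient.mk_eq_zero, hm, Submodule.ideal_span_singleton_smul,
      Submodule.mem_smul_pointwise_iff_exists] at h4
    obtain ⟨v', -, hv'⟩ := h4
    obtain ⟨t, ht⟩ := h v v' hv'.symm
    change residue O (φ v) = 0
    rw [residue_eq_zero_iff, hm, Ideal.mem_span_singleton]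
    exact ⟨t, ht⟩
  obtain ⟨q', hq'⟩ := h3
  -- Projectivity of `V'` lifts the functional back to `O`; the error `φ - q ∘ D` is divisible by
  -- `ε`, which yields `p`.
  obtain ⟨q, hq⟩ := Module.projective_lifting_property (Algebra.linearMap O (ResidueField O))
    (q'.restrictScalars O ∘ₗ Submodule.mkQ _) hs
  obtain ⟨p, hp⟩ := exists_smul_eq (R := O) hε.ne_zero (φ - q ∘ₗ D) (fun v => by
    have h4 : residue O (φ v - q (D v)) = 0 := by
      rw [map_sub, sub_eq_zero]
      have h5 : residue O (q (D v)) = q' (Submodule.Quotient.mk (D v)) :=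
        LinearMap.congr_fun hq (D v)
      rw [h5]
      exact (LinearMap.congr_fun hq' (Submodule.Quotient.mk v)).symm
    rw [residue_eq_zero_iff, hm, Ideal.mem_span_singleton] at h4
    obtain ⟨t, ht⟩ := h4
    exact ⟨t, ht.symm⟩)
  refine ⟨q, p, fun v => ?_⟩
  have := hp v
  simp only [smul_eq_mul, LinearMap.sub_apply, LinearMap.comp_apply] at this
  rw [this]
  ring

end Divisibility
-- Shifts of tuples and their adjointness
section Shift

variable {n : ℕ} {α β γ : Type*}

/-- The shift `(f₁, …, fₙ) ↦ (f₂, …, fₙ, 0)`. -/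
def shiftUp [Zero α] (f : Fin n → α) (i : Fin n) : α :=
  if h : i.val + 1 < n then f ⟨i.val + 1, h⟩ else 0

/-- The shift `(f₁, …, fₙ) ↦ (0, f₁, …, fₙ₋₁)`. -/
def shiftDown [Zero α] (f : Fin n → α) (i : Fin n) : α :=
  if 0 < i.val then f ⟨i.val - 1, by omega⟩ else 0

theorem map_shiftUp [Zero α] [Zero β] (φ : α → β) (h : φ 0 = 0) (f : Fin n → α) (i : Fin n) :
    φ (shiftUp f i) = shiftUp (fun j => φ (f j)) i := by
  unfold shiftUp
  split_ifs <;> simp [h]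

theorem map_shiftDown [Zero α] [Zero β] (φ : α → β) (h : φ 0 = 0) (f : Fin n → α) (i : Fin n) :
    φ (shiftDown f i) = shiftDown (fun j => φ (f j)) i := by
  unfold shiftDown
  split_ifs <;> simp [h]

theorem shiftUp_eq_sum [AddCommMonoid α] (f : Fin n → α) (i : Fin n) :
    shiftUp f i = ∑ j, if i.val + 1 = j.val then f j else 0 := by
  unfold shiftUp
  split_ifs with h
  · rw [Finset.sum_eq_single ⟨i.val + 1, h⟩]
    · simp
    · intro j _ hj
      rw [if_neg]
      intro h'
      exact hj (Fin.ext h'.symm)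
    · simp
  · rw [Finset.sum_eq_zero]
    intro j _
    rw [if_neg]
    omega

theorem shiftDown_eq_sum [AddCommMonoid α] (f : Fin n → α) (i : Fin n) :
    shiftDown f i = ∑ j, if j.val + 1 = i.val then f j else 0 := by
  unfold shiftDown
  split_ifs with h
  · rw [Finset.sum_eq_single ⟨i.val - 1, by omega⟩]
    · rw [if_pos]
      simp only
      omega
    · intro j _ hj
      rw [if_neg]
      intro h'
      apply hj
      apply Fin.ext
      simp only
      omega
    · simp
  · rw [Finset.sum_eq_zero]
    intro j _
    rw [if_neg]
    omega

/-- The two shifts are adjoint with respect to each biadditive pairing. -/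
theorem sum_shiftUp_eq_sum_shiftDown [Zero α] [Zero β] [AddCommMonoid γ] (B : α → β → γ)
    (h₁ : ∀ b, B 0 b = 0) (h₂ : ∀ a, B a 0 = 0) (f : Fin n → α) (g : Fin n → β) :
    ∑ i, B (f i) (shiftUp g i) = ∑ i, B (shiftDown f i) (g i) := by
  have e₁ (i : Fin n) : B (f i) (shiftUp g i) =
      ∑ j : Fin n, if i.val + 1 = j.val then B (f i) (g j) else 0 := by
    rw [map_shiftUp (B (f i)) (h₂ _), shiftUp_eq_sum]
  have e₂ (j : Fin n) : B (shiftDown f j) (g j) =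
      ∑ i : Fin n, if i.val + 1 = j.val then B (f i) (g j) else 0 := by
    rw [map_shiftDown (fun a => B a (g j)) (h₁ _), shiftDown_eq_sum]
  simp only [e₁, e₂]
  exact Finset.sum_comm

end Shift

/-! ### Coordinates on the Heller lattice and the relation between `a1` and `a3` -/

section Heller

variable {O : Type u} [CommRing O]

theorem isLattice_pi (ι : Type) [Fintype ι] : IsLattice O (ι → A O) :=
  ⟨inferInstance, inferInstance⟩

/-- The linear map `D` on `Wⁿ` with `(D w)ₖ = (Y - l X) wₖ - X wₖ₋₁`. -/
noncomputable def shiftMap (n : ℕ) (l : O) (W : Type*) [AddCommGroup W] [Module O W]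
    [Module (A O) W] [IsScalarTower O (A O) W] : (Fin n → W) →ₗ[O] (Fin n → W) where
  toFun w k := (y O - l • x O) • w k - x O • shiftDown w k
  map_add' v w := by
    funext k
    by_cases h : 0 < k.val <;>
      simp only [shiftDown, h, if_true, if_false, Pi.add_apply, smul_add, smul_zero] <;> abel
  map_smul' r w := by
    funext k
    by_cases h : 0 < k.val <;>
      simp only [shiftDown, h, if_true, if_false, Pi.smul_apply, smul_sub, smul_zero,
        RingHom.id_apply, smul_comm r]

theorem shiftMap_apply {n : ℕ} (l : O) {W : Type*} [AddCommGroup W] [Module O W] [Module (A O) W]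
    [IsScalarTower O (A O) W] (w : Fin n → W) (k : Fin n) :
    shiftMap n l W w k = (y O - l • x O) • w k - x O • shiftDown w k := rfl

variable [IsLocalRing O]

theorem jordan_mulVec (n : ℕ) (c : IsLocalRing.ResidueField O)
    (v : Fin n → IsLocalRing.ResidueField O) (i : Fin n) :
    (jordan n c).mulVec v i = c * v i + shiftUp v i := by
  rw [shiftUp_eq_sum, Matrix.mulVec, dotProduct]
  have h (j : Fin n) : jordan n c i j * v j =
      (if i = j then c * v j else 0) + (if i.val + 1 = j.val then v j else 0) := by
    unfold jordan
    by_cases h1 : i = j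
    · subst h1; simp
    · by_cases h2 : i.val + 1 = j.val <;> simp [h1, h2]
  simp [h, Finset.sum_add_distrib]

theorem mem_Z_iff {ε : O} (hm : IsLocalRing.maximalIdeal O = Ideal.span {ε}) (n : ℕ) (l : O)
    (z : Fin n → A O) : z ∈ Z n (IsLocalRing.residue O l) ↔
      ∀ i, ε ∣ c0 (z i) ∧ ε ∣ cX (z i) + l * cY (z i) + shiftUp (fun j => cY (z j)) i := by
  rw [mem_Z, forall_and, funext_iff]
  refine and_congr (forall_congr' fun i => ?_) (forall_congr' fun i => ?_)
  · rw [IsLocalRing.residue_eq_zero_iff, hm, Ideal.mem_span_singleton]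
  · rw [← Ideal.mem_span_singleton, ← hm, ← IsLocalRing.residue_eq_zero_iff, Pi.add_apply,
      jordan_mulVec, map_add, map_add, map_mul, map_shiftUp (IsLocalRing.residue O) (map_zero _),
      add_assoc]
    rfl

theorem a3_apply (n : ℕ) (l : O) (k j : Fin n) : (a3 n l k).1 j =
    (y O - l • x O) * (e k : Fin n → A O) j - x O * (ePred k : Fin n → A O) j := by
  change y O * (e k : Fin n → A O) j - (l • x O) * (e k : Fin n → A O) j -
    x O * (ePred k : Fin n → A O) j = _
  rw [sub_mul]

/-- The term `-X e_{k-1}` of `a_{k,3}` feeds the coordinate `k - 1`, so the coordinate `j` sees the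
coefficient with index `j + 1`: an upward shift here, but a downward one in `shiftMap`. -/
theorem piMap_apply {n : ℕ} (l ε : O) (hε : ¬ IsUnit ε) (v : Fin n × Fin 2 → A O) (j : Fin n) :
    (piMap n l ε hε v).1 j = ε • v (j, 0) + (y O - l • x O) * v (j, 1) -
      x O * shiftUp (fun k => v (k, 1)) j := by
  have h1 : (piMap n l ε hε v).1 j = ∑ k : Fin n, (v (k, 0) * (ε • (e k : Fin n → A O) j) +
      v (k, 1) * (a3 n l k).1 j) := by
    rw [piMap, Fintype.linearCombination_apply, Fintype.sum_prod_type]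
    simp [a1]
  have h2 (k : Fin n) : v (k, 0) * (ε • (e k : Fin n → A O) j) + v (k, 1) * (a3 n l k).1 j =
      (if j = k then ε • v (k, 0) + (y O - l • x O) * v (k, 1) else 0) -
        x O * (if j.val + 1 = k.val then v (k, 1) else 0) := by
    rw [a3_apply]
    by_cases h : j = k
    · subst h
      simp [e, ePred, mul_comm]
    · by_cases h' : j.val + 1 = k.val
      · simp only [e, ePred, h, h', Pi.single_apply, if_true, if_false, mul_zero, smul_zero,
          mul_one, zero_sub, zero_add]
        exact (mul_neg _ _).trans (congrArg _ (mul_comm _ _))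
      · simp [e, ePred, h, h']
  rw [h1, shiftUp_eq_sum]
  simp only [h2]
  rw [Finset.sum_sub_distrib, Finset.mul_sum]
  simp

/-- The defining relation of `Z`: it ties every homomorphism out of `Z` to its values on the
`a_{k,1}`. -/
theorem smul_a3 (n : ℕ) (l ε : O) (hε : ¬ IsUnit ε) :
    (fun k => ε • a3 n l k) = shiftMap n l (Z n (IsLocalRing.residue O l))
      (a1 n (IsLocalRing.residue O l) ε hε) := by
  funext k
  apply Subtype.ext
  funext j
  rw [shiftMap_apply]
  change ε • (a3 n l k).1 j = (y O - l • x O) * (ε • (e k : Fin n → A O) j) -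
    x O * (shiftDown (a1 n (IsLocalRing.residue O l) ε hε) k).1 j
  have h := map_shiftDown (fun z : Z n (IsLocalRing.residue O l) => z.1 j) rfl
    (a1 n (IsLocalRing.residue O l) ε hε) k
  rw [h, shiftDown_eq_sum, Finset.sum_congr rfl (g := fun i : Fin n => if j = i then
    (if i.val + 1 = k.val then ε • (1 : A O) else 0) else 0)]
  · rw [Finset.sum_ite_eq, if_pos (Finset.mem_univ _), a3_apply, smul_sub]
    congr 1
    · rw [mul_smul_comm]
    · rw [ePred]
      split_ifs <;> simp
  · intro i _
    change (if i.val + 1 = k.val then ε • (e i : Fin n → A O) j else 0) = _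
    by_cases h1 : j = i
    · subst h1; simp [e]
    · simp [e, h1]

end Heller

/-! ### Generators of the Heller lattice and the projective cover -/

section DVR

variable {O : Type u} [CommRing O] [IsDomain O] [IsDiscreteValuationRing O]

theorem isLattice_Z (n : ℕ) (c : IsLocalRing.ResidueField O) : IsLattice O (Z n c) :=
  (isLattice_pi (Fin n)).submodule _

theorem finite_Z (n : ℕ) (c : IsLocalRing.ResidueField O) : Module.Finite (A O) (Z n c) :=
  have := (isLattice_Z n c).2
  Module.Finite.of_restrictScalars_finite O (A O) _

theorem nontrivial_Z {n : ℕ} (hn : 0 < n) (c : IsLocalRing.ResidueField O) :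
    Nontrivial (Z n c) := by
  refine ⟨a4 n c ⟨0, hn⟩, 0, fun h => ?_⟩
  have h1 : (x O * y O) * (e ⟨0, hn⟩ : Fin n → A O) ⟨0, hn⟩ = 0 :=
    congrFun (congrArg Subtype.val h) ⟨0, hn⟩
  have h2 := congrArg cXY h1
  simp [e] at h2

/-- A preimage under `piMap`: its components at `(k, 0)` have the constant coefficients
`a1Coeff k z`, and the ones at `(k, 1)` have the constant coefficients `cY (z k)`. -/
theorem exists_piMap_eq {n : ℕ} (l : O) {ε : O} (hε : Irreducible ε)
    (z : Z n (IsLocalRing.residue O l)) :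
    ∃ v, piMap n l ε hε.not_isUnit v = z ∧
      (∀ k, c0 (v (k, 0)) = a1Coeff n _ ε hε k z) ∧ ∀ k, c0 (v (k, 1)) = cY (z.1 k) := by
  have h (k : Fin n) := ((mem_Z_iff hε.maximalIdeal_eq n l z.1).1 z.2 k).2
  choose t ht using h
  -- The `a_{k,3}`-part is chosen to match the `Y`- and `XY`-coefficients of `z`. The remaining
  -- `X`-coefficient is then `cX + l cY + shiftUp cY`, which membership in `Z` makes equal to `ε t`.
  let v : Fin n × Fin 2 → A O := fun p =>
    if p.2 = 0 then a1Coeff n _ ε hε p.1 z • 1 + t p.1 • x O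
    else cY (z.1 p.1) • 1 + cXY (z.1 p.1) • x O
  have hv0 (k : Fin n) : v (k, 0) = a1Coeff n _ ε hε k z • 1 + t k • x O := rfl
  have hv1 (k : Fin n) : v (k, 1) = cY (z.1 k) • 1 + cXY (z.1 k) • x O := rfl
  refine ⟨v, ?_, fun k => ?_, fun k => ?_⟩
  · apply Subtype.ext
    funext j
    rw [piMap_apply, hv0]
    simp only [hv1]
    have e0 := map_shiftUp (c0 (O := O)) c0_zero
      (fun k => cY (z.1 k) • (1 : A O) + cXY (z.1 k) • x O) j
    have eX := map_shiftUp (cX (O := O)) cX_zero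
      (fun k => cY (z.1 k) • (1 : A O) + cXY (z.1 k) • x O) j
    have eY := map_shiftUp (cY (O := O)) cY_zero
      (fun k => cY (z.1 k) • (1 : A O) + cXY (z.1 k) • x O) j
    have h0 (k : Fin n) : c0 (cY (z.1 k) • (1 : A O) + cXY (z.1 k) • x O) = cY (z.1 k) := by simp
    have hY (k : Fin n) : cY (cY (z.1 k) • (1 : A O) + cXY (z.1 k) • x O) = 0 := by simp
    simp only [h0] at e0
    simp only [hY] at eY
    have eY' : shiftUp (fun _ : Fin n => (0 : O)) j = 0 := by simp [shiftUp]
    rw [eY'] at eY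
    apply ext_coeff
    · simp [a1Coeff_spec]
    · simp [e0, mul_add]
      linear_combination -ht j
    · simp
    · simp [eY]
  · rw [hv0]; simp
  · rw [hv1]; simp

theorem piMap_surjective (n : ℕ) (l : O) {ε : O} (hε : Irreducible ε) :
    Function.Surjective (piMap n l ε hε.not_isUnit) := fun z =>
  let ⟨v, hv, _⟩ := exists_piMap_eq l hε z
  ⟨v, hv⟩

/-- Modulo `maxIdeal`, the elements `a1` and `a3` span the Heller lattice. -/
theorem sub_sum_mem_maxIdeal_smul {n : ℕ} (l : O) {ε : O} (hε : Irreducible ε)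
    (z : Z n (IsLocalRing.residue O l)) :
    z - ∑ k, (a1Coeff n _ ε hε k z • a1 n _ ε hε.not_isUnit k + cY (z.1 k) • a3 n l k) ∈
      maxIdeal O • (⊤ : Submodule (A O) (Z n (IsLocalRing.residue O l))) := by
  obtain ⟨v, hv, h0, h1⟩ := exists_piMap_eq l hε z
  nth_rewrite 1 [← hv]
  rw [piMap, Fintype.linearCombination_apply, Fintype.sum_prod_type, ← Finset.sum_sub_distrib]
  refine Submodule.sum_mem _ fun k _ => ?_
  rw [Fin.sum_univ_two, add_sub_add_comm]
  exact add_mem (smul_sub_smul_mem_maxIdeal_smul (h0 k) _)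
    (smul_sub_smul_mem_maxIdeal_smul (h1 k) _)

/-- The constant and `Y`-coefficients of `π v = 0` give this. It places the kernel inside `maxIdeal
• ⊤`, so that the kernel is superfluous by Nakayama. -/
theorem c0_mem_of_piMap_eq_zero {n : ℕ} (l : O) {ε : O} (hε : Irreducible ε)
    {v : Fin n × Fin 2 → A O} (hv : piMap n l ε hε.not_isUnit v = 0) (p : Fin n × Fin 2) :
    ε ∣ c0 (v p) := by
  obtain ⟨k, i⟩ := p
  have h : ε • v (k, 0) + (y O - l • x O) * v (k, 1) -
      x O * shiftUp (fun k => v (k, 1)) k = 0 := by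
    rw [← piMap_apply l ε hε.not_isUnit, hv]
    rfl
  fin_cases i
  · have h0 := congrArg c0 h
    simp [hε.ne_zero] at h0
    simp [h0]
  · have hY := congrArg cY h
    simp at hY
    exact ⟨-cY (v (k, 0)), by simp; linear_combination hY⟩

theorem isProjectiveCover_piMap (n : ℕ) (l : O) {ε : O} (hε : Irreducible ε) :
    IsProjectiveCover (piMap n l ε hε.not_isUnit) := by
  refine ⟨inferInstance, piMap_surjective n l hε, fun Q hQ => eq_top_of_sup_maxIdeal_smul ?_⟩
  have h (v : Fin n × Fin 2 → A O) (hv : piMap n l ε hε.not_isUnit v = 0) :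
      v ∈ maxIdeal O • (⊤ : Submodule (A O) (Fin n × Fin 2 → A O)) := by
    apply mem_maxIdeal_smul_of_forall
    intro p
    rw [mem_maxIdeal, hε.maximalIdeal_eq, Ideal.mem_span_singleton]
    exact c0_mem_of_piMap_eq_zero l hε hv p
  rw [eq_top_iff]
  refine hQ.ge.trans ?_
  rw [sup_comm]
  exact sup_le_sup_left h _

end DVR
-- Endomorphisms of the Heller lattice as Toeplitz matrices modulo `ε`
section LocalEnd

/-- Forward substitution: in column `k` the terms below the diagonal lie in `Q` by `hlt`, those
above it by induction. -/
theorem mem_of_triangular {O : Type u} [CommRing O] {n : ℕ} {V : Type*} [AddCommGroup V]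
    [Module O V] (Q : Submodule O V)
    (v : Fin n → V) (S : Fin n → Fin n → O) (h : ∀ k, ∑ j, S j k • v j ∈ Q)
    (hlt : ∀ j k, k < j → S j k • v j ∈ Q) (hS : ∀ k, IsUnit (S k k)) (k : Fin n) : v k ∈ Q := by
  induction k using WellFoundedLT.induction with
  | ind k ih =>
    have h1 := h k
    rw [← Finset.add_sum_erase _ _ (Finset.mem_univ k)] at h1
    have h2 : ∑ j ∈ Finset.univ.erase k, S j k • v j ∈ Q := by
      refine Submodule.sum_mem _ fun j hj => ?_
      rcases lt_or_gt_of_ne (Finset.ne_of_mem_erase hj) with hjk | hjk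
      · exact Q.smul_mem _ (ih j hjk)
      · exact hlt j k hjk
    have h3 := (Submodule.add_mem_iff_left _ h2).1 h1
    exact (Submodule.smul_mem_iff_of_isUnit Q (hS k)).1 h3

variable {O : Type u} [CommRing O] [IsDomain O] [IsDiscreteValuationRing O]

/-- `a1Coeff` as a linear map. -/
noncomputable def a1CoeffHom (n : ℕ) (c : IsLocalRing.ResidueField O) {ε : O} (hε : Irreducible ε)
    (i : Fin n) : Z n c →ₗ[O] O where
  toFun := a1Coeff n c ε hε i
  map_add' z w := by
    apply mul_left_cancel₀ hε.ne_zero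
    rw [mul_add]
    simp only [a1Coeff_spec]
    exact c0_add _ _
  map_smul' r z := by
    apply mul_left_cancel₀ hε.ne_zero
    rw [RingHom.id_apply, smul_eq_mul, mul_left_comm]
    simp only [a1Coeff_spec]
    exact c0_smul _ _

theorem a1CoeffHom_apply (n : ℕ) (c : IsLocalRing.ResidueField O) {ε : O} (hε : Irreducible ε)
    (i : Fin n) (z : Z n c) : a1CoeffHom n c hε i z = a1Coeff n c ε hε i z := rfl

theorem a1CoeffHom_a1 (n : ℕ) (c : IsLocalRing.ResidueField O) {ε : O} (hε : Irreducible ε)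
    (i k : Fin n) : a1CoeffHom n c hε i (a1 n c ε hε.not_isUnit k) = if i = k then 1 else 0 := by
  apply mul_left_cancel₀ hε.ne_zero
  rw [a1CoeffHom_apply, a1Coeff_spec]
  change c0 (ε • (e k : Fin n → A O) i) = _
  by_cases hk : i = k
  · subst hk; simp [e]
  · simp [e, hk]

theorem smul_map_a3 {n : ℕ} (l ε : O) (hε : ¬ IsUnit ε) {W : Type*} [AddCommGroup W] [Module O W]
    [Module (A O) W] [IsScalarTower O (A O) W] (ψ : Z n (IsLocalRing.residue O l) →ₗ[A O] W)
    (k : Fin n) : ε • ψ (a3 n l k) =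
      shiftMap n l W (fun i => ψ (a1 n (IsLocalRing.residue O l) ε hε i)) k := by
  have h := congrFun (smul_a3 n l ε hε) k
  rw [← LinearMap.map_smul_of_tower, h, shiftMap_apply, shiftMap_apply, map_sub, map_smul, map_smul,
    map_shiftDown ψ (map_zero ψ)]

section

variable {n : ℕ} {l ε : O} (hε : Irreducible ε)
  (s : Z n (IsLocalRing.residue O l) →ₗ[A O] Z n (IsLocalRing.residue O l))

theorem smul_map_a3_apply (j k : Fin n) : ε • (s (a3 n l k)).1 j =
    (y O - l • x O) * (s (a1 n _ ε hε.not_isUnit k)).1 j -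
      x O * shiftDown (fun i => (s (a1 n _ ε hε.not_isUnit i)).1 j) k := by
  have h := congrFun (congrArg Subtype.val (smul_map_a3 l ε hε.not_isUnit s k)) j
  rw [shiftMap_apply] at h
  rw [← map_shiftDown (fun z : Z n (IsLocalRing.residue O l) => z.1 j) rfl]
  exact h

theorem c0_map_a3 {n : ℕ} {l ε : O} (hε : Irreducible ε)
    (s : Z n (IsLocalRing.residue O l) →ₗ[A O] Z n (IsLocalRing.residue O l)) (j k : Fin n) :
    c0 ((s (a3 n l k)).1 j) = 0 := by
  have h := congrArg c0 (smul_map_a3_apply hε s j k)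
  simpa [hε.ne_zero] using h

/-- With `S j k` the `a_{j,1}`-coefficient of `s(a_{k,1})`, this and `cX_map_a3` read off the `Y`-
and `X`-coefficients of `s(a_{k,3})` from `S`, by dividing the relation by `ε`. -/
theorem cY_map_a3 (j k : Fin n) : cY ((s (a3 n l k)).1 j) =
    a1CoeffHom n _ hε j (s (a1 n _ ε hε.not_isUnit k)) := by
  apply mul_left_cancel₀ hε.ne_zero
  have h := congrArg cY (smul_map_a3_apply hε s j k)
  rw [a1CoeffHom_apply, a1Coeff_spec]
  simpa using h

theorem cX_map_a3 (j k : Fin n) : cX ((s (a3 n l k)).1 j) =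
    -(l * a1CoeffHom n _ hε j (s (a1 n _ ε hε.not_isUnit k))) -
      shiftDown (fun i => a1CoeffHom n _ hε j (s (a1 n _ ε hε.not_isUnit i))) k := by
  apply mul_left_cancel₀ hε.ne_zero
  have h := congrArg cX (smul_map_a3_apply hε s j k)
  rw [mul_sub, map_shiftDown (fun r => ε * r) (mul_zero ε), mul_neg, mul_left_comm]
  simp only [a1CoeffHom_apply, a1Coeff_spec]
  simp only [cX_smul, cX_sub, cX_mul, c0_sub, c0_smul, cX_smul, c0_x, c0_y, cX_x, cX_y]
    at h
  rw [map_shiftDown (c0 (O := O)) c0_zero] at h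
  rw [h]
  ring

/-- The matrix of coefficients of an endomorphism at the `a1` is modulo `ε` an upper triangular
Toeplitz matrix. -/
theorem dvd_shiftUp_sub_shiftDown (j k : Fin n) :
    ε ∣ shiftUp (fun i => a1CoeffHom n _ hε i (s (a1 n _ ε hε.not_isUnit k))) j -
      shiftDown (fun i => a1CoeffHom n _ hε j (s (a1 n _ ε hε.not_isUnit i))) k := by
  -- Membership of `s(a_{k,3})` in `Z` is the congruence `S (j+1) k ≡ S j (k-1)`: modulo `ε`, `S`
  -- commutes with the nilpotent Jordan block.
  have h := ((mem_Z_iff hε.maximalIdeal_eq n l _).1 (s (a3 n l k)).2 j).2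
  simp only [cX_map_a3 hε, cY_map_a3 hε] at h
  convert h using 1
  ring

/-- The congruence moves an entry below the diagonal up and left until it reaches the first column,
where the shifted entry is the default `0`. -/
theorem dvd_a1CoeffHom_of_lt : ∀ (j k : Fin n), k < j →
    ε ∣ a1CoeffHom n _ hε j (s (a1 n _ ε hε.not_isUnit k)) := by
  rintro ⟨j, hj⟩ ⟨k, hk⟩ hkj
  simp only [Fin.mk_lt_mk] at hkj
  induction k generalizing j with
  | zero =>
    have h := dvd_shiftUp_sub_shiftDown hε s ⟨j - 1, by omega⟩ ⟨0, hk⟩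
    have h1 : j - 1 + 1 = j := by omega
    simpa [shiftUp, shiftDown, h1, hj] using h
  | succ k ih =>
    have h := dvd_shiftUp_sub_shiftDown hε s ⟨j - 1, by omega⟩ ⟨k + 1, hk⟩
    have h1 : j - 1 + 1 = j := by omega
    simp only [shiftUp, shiftDown, h1, hj, dite_true, Nat.succ_pos, if_true,
      Nat.add_sub_cancel] at h
    exact (dvd_sub_left (ih (j - 1) _ (by omega) (by omega))).1 h

theorem dvd_a1CoeffHom_sub (k : Fin n) (hn : 0 < n) :
    ε ∣ a1CoeffHom n _ hε k (s (a1 n _ ε hε.not_isUnit k)) -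
      a1CoeffHom n _ hε ⟨n - 1, by omega⟩ (s (a1 n _ ε hε.not_isUnit ⟨n - 1, by omega⟩)) := by
  have main (m : ℕ) (hm : m < n) :
      ε ∣ a1CoeffHom n _ hε ⟨m, hm⟩ (s (a1 n _ ε hε.not_isUnit ⟨m, hm⟩)) -
        a1CoeffHom n _ hε ⟨0, hn⟩ (s (a1 n _ ε hε.not_isUnit ⟨0, hn⟩)) := by
    induction m with
    | zero => simp
    | succ m ih =>
      have h := dvd_shiftUp_sub_shiftDown hε s ⟨m, by omega⟩ ⟨m + 1, hm⟩
      simp only [shiftUp, shiftDown, hm, dite_true, Nat.succ_pos, if_true,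
        Nat.add_sub_cancel] at h
      have := dvd_add h (ih (by omega))
      rwa [sub_add_sub_cancel] at this
  have h := dvd_sub (main k.1 k.2) (main (n - 1) (by omega))
  rwa [sub_sub_sub_cancel_right] at h

end

/-- The last diagonal entry of `S` is congruent to all others, so all are units. Modulo `maxIdeal`,
`s` acts on the `a_{k,3}` by `S`, and on the `a_{k,1}` by `S` up to terms in the `a_{k,3}`.
Triangularity and Nakayama give surjectivity, which implies injectivity for a finite module. -/
theorem bijective_of_not_dvd {n : ℕ} (hn : 0 < n) {l ε : O} (hε : Irreducible ε)
    (s : Z n (IsLocalRing.residue O l) →ₗ[A O] Z n (IsLocalRing.residue O l))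
    (h : ¬ ε ∣ a1CoeffHom n _ hε ⟨n - 1, by omega⟩
      (s (a1 n _ ε hε.not_isUnit ⟨n - 1, by omega⟩))) : Function.Bijective s := by
  have := finite_Z n (IsLocalRing.residue O l)
  suffices hs : Function.Surjective s from
    ⟨OrzechProperty.injective_of_surjective_endomorphism s hs, hs⟩
  rw [← LinearMap.range_eq_top]
  apply eq_top_of_sup_maxIdeal_smul
  set Q : Submodule (A O) (Z n (IsLocalRing.residue O l)) := LinearMap.range s ⊔ maxIdeal O • ⊤
    with hQ
  have hm {r : O} (hr : ε ∣ r) (z : Z n (IsLocalRing.residue O l)) :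
      r • z ∈ Q.restrictScalars O := by
    refine Submodule.mem_sup_right (smul_mem_maxIdeal_smul ?_ z)
    rwa [hε.maximalIdeal_eq, Ideal.mem_span_singleton]
  have hunit (k : Fin n) :
      IsUnit (a1CoeffHom n _ hε k (s (a1 n _ ε hε.not_isUnit k))) := by
    by_contra hu
    have h1 : a1CoeffHom n _ hε k (s (a1 n _ ε hε.not_isUnit k)) ∈ IsLocalRing.maximalIdeal O := hu
    rw [hε.maximalIdeal_eq, Ideal.mem_span_singleton] at h1
    exact h ((dvd_sub_right h1).1 (dvd_a1CoeffHom_sub hε s k hn))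
  have hsum (z : Z n (IsLocalRing.residue O l)) :
      ∑ k, (a1Coeff n _ ε hε k (s z) • a1 n _ ε hε.not_isUnit k + cY ((s z).1 k) • a3 n l k) ∈
        Q.restrictScalars O := by
    have h1 : s z ∈ Q := Submodule.mem_sup_left ⟨z, rfl⟩
    have h2 := Q.sub_mem h1 (Submodule.mem_sup_right (sub_sum_mem_maxIdeal_smul l hε (s z)))
    rwa [sub_sub_cancel] at h2
  have h3 (k : Fin n) : a3 n l k ∈ Q.restrictScalars O := by
    refine mem_of_triangular (Q.restrictScalars O) (a3 n l)
      (fun j k => a1CoeffHom n _ hε j (s (a1 n _ ε hε.not_isUnit k))) (fun k => ?_)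
      (fun j k hkj => hm (dvd_a1CoeffHom_of_lt hε s j k hkj) _) hunit k
    have h1 := hsum (a3 n l k)
    have h0 (j : Fin n) : a1Coeff n _ ε hε j (s (a3 n l k)) = 0 := by
      apply mul_left_cancel₀ hε.ne_zero
      rw [a1Coeff_spec, c0_map_a3 hε, mul_zero]
    simpa only [h0, cY_map_a3 hε, zero_smul, zero_add] using h1
  have h1 (k : Fin n) : a1 n _ ε hε.not_isUnit k ∈ Q.restrictScalars O := by
    refine mem_of_triangular (Q.restrictScalars O) (a1 n _ ε hε.not_isUnit)
      (fun j k => a1CoeffHom n _ hε j (s (a1 n _ ε hε.not_isUnit k))) (fun k => ?_)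
      (fun j k hkj => hm (dvd_a1CoeffHom_of_lt hε s j k hkj) _) hunit k
    have h1 := hsum (a1 n _ ε hε.not_isUnit k)
    rw [Finset.sum_add_distrib] at h1
    exact (Submodule.add_mem_iff_left _
      (Submodule.sum_mem _ fun j _ => Submodule.smul_mem _ _ (h3 j))).1 h1
  rw [eq_top_iff]
  intro z _
  have h4 : ∑ k, (a1Coeff n _ ε hε k z • a1 n _ ε hε.not_isUnit k + cY (z.1 k) • a3 n l k) ∈
      Q.restrictScalars O :=
    Submodule.sum_mem _ fun k _ =>
      add_mem (Submodule.smul_mem _ _ (h1 k)) (Submodule.smul_mem _ _ (h3 k))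
  have h5 := Q.add_mem (Submodule.mem_sup_right (sub_sum_mem_maxIdeal_smul l hε z)) h4
  rwa [sub_add_cancel] at h5

/-- The last diagonal entries of `s` and `1 - s` add up to `1`, so `ε` cannot divide both. -/
theorem hasLocalEnd_Z {n : ℕ} (hn : 0 < n) (c : IsLocalRing.ResidueField O) :
    HasLocalEnd (A O) (Z n c) := by
  obtain ⟨l, rfl⟩ := IsLocalRing.residue_surjective c
  obtain ⟨ε, hε⟩ := IsDiscreteValuationRing.exists_irreducible O
  intro s
  by_cases h : ε ∣ a1CoeffHom n _ hε ⟨n - 1, by omega⟩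
      (s (a1 n _ ε hε.not_isUnit ⟨n - 1, by omega⟩))
  · right
    refine bijective_of_not_dvd hn hε _ fun h' => hε.not_isUnit (isUnit_of_dvd_one ?_)
    rw [LinearMap.sub_apply, map_sub, LinearMap.id_apply, a1CoeffHom_a1, if_pos rfl] at h'
    exact (dvd_sub_left h).1 h'
  · left
    exact bijective_of_not_dvd hn hε s h

end LocalEnd
-- The kernel of `π` as the Heller lattice for `-λ`
section Kernel

variable {O : Type u} [CommRing O]

/-- Alternating signs negate the shift. In the kernel condition, `-λ` appears together with a
negated shift; the signs restore the shift and leave the parameter `-λ`. -/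
theorem shiftUp_neg_one_pow_mul {n : ℕ} (f : Fin n → O) (i : Fin n) :
    shiftUp (fun j => (-1) ^ j.val * f j) i = -((-1) ^ i.val * shiftUp f i) := by
  unfold shiftUp
  split_ifs
  · simp [pow_succ]
  · simp

theorem exists_smul_eq_of_dvd {r : O} {a : A O} (h0 : r ∣ c0 a) (hX : r ∣ cX a) (hY : r ∣ cY a)
    (hXY : r ∣ cXY a) : ∃ b : A O, r • b = a := by
  obtain ⟨t0, h0⟩ := h0
  obtain ⟨t1, hX⟩ := hX
  obtain ⟨t2, hY⟩ := hY
  obtain ⟨t3, hXY⟩ := hXY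
  refine ⟨t0 • 1 + t1 • x O + t2 • y O + t3 • (x O * y O), ?_⟩
  rw [eq_sum_coeff a, h0, hX, hY, hXY]
  simp only [smul_add, mul_smul]

/-- The map `A²ⁿ → Aⁿ`, `(p, q) ↦ ((-1)ᵏ qₖ)ₖ`. -/
noncomputable def signedSnd (n : ℕ) (O : Type u) [CommRing O] :
    (Fin n × Fin 2 → A O) →ₗ[A O] (Fin n → A O) :=
  LinearMap.pi fun k => ((-1 : O) ^ k.val) • LinearMap.proj (k, 1)

theorem signedSnd_apply {n : ℕ} (v : Fin n × Fin 2 → A O) (k : Fin n) :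
    signedSnd n O v k = (-1 : O) ^ k.val • v (k, 1) := rfl

variable [IsDomain O] [IsDiscreteValuationRing O]

theorem mem_Z_neg_iff {n : ℕ} (l : O) {ε : O} (hε : Irreducible ε) (z : Fin n → A O) :
    z ∈ Z n (-IsLocalRing.residue O l) ↔
      ∀ i, ε ∣ c0 (z i) ∧ ε ∣ cX (z i) - l * cY (z i) + shiftUp (fun j => cY (z j)) i := by
  rw [← map_neg, mem_Z_iff hε.maximalIdeal_eq]
  simp only [neg_mul, ← sub_eq_add_neg]

/-- The `XY`-coefficient of `π v = 0`, multiplied by `(-1)ᵏ`, is the second membership condition for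
the parameter `-λ`. -/
theorem signedSnd_mem {n : ℕ} (l : O) {ε : O} (hε : Irreducible ε) {v : Fin n × Fin 2 → A O}
    (hv : piMap n l ε hε.not_isUnit v = 0) :
    signedSnd n O v ∈ Z n (-IsLocalRing.residue O l) := by
  rw [mem_Z_neg_iff l hε]
  intro k
  have h : ε • v (k, 0) + (y O - l • x O) * v (k, 1) -
      x O * shiftUp (fun k => v (k, 1)) k = 0 := by
    rw [← piMap_apply l ε hε.not_isUnit, hv]
    rfl
  have hXY := congrArg cXY h
  simp only [cXY_add, cXY_sub, cXY_smul, cXY_mul, c0_sub, cX_sub, cY_sub, c0_smul, cX_smul,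
    cY_smul, c0_x, c0_y, cX_x, cX_y, cY_x, cY_y, cXY_x, cXY_y, cXY_zero] at hXY
  rw [map_shiftUp (cY (O := O)) cY_zero] at hXY
  simp only [signedSnd_apply, c0_smul, cX_smul, cY_smul, shiftUp_neg_one_pow_mul]
  refine ⟨(c0_mem_of_piMap_eq_zero l hε hv (k, 1)).mul_left _, -((-1) ^ k.val * cXY (v (k, 0))), ?_⟩
  linear_combination (-1) ^ k.val * hXY

theorem eq_zero_of_signedSnd_eq_zero {n : ℕ} (l : O) {ε : O} (hε : Irreducible ε)
    {v : Fin n × Fin 2 → A O} (hv : piMap n l ε hε.not_isUnit v = 0)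
    (h : signedSnd n O v = 0) : v = 0 := by
  have h1 (k : Fin n) : v (k, 1) = 0 := by
    have h2 := congrFun h k
    rw [signedSnd_apply] at h2
    exact (((isUnit_one.neg (α := O)).pow k.val).smul_eq_zero).1 h2
  funext p
  obtain ⟨k, i⟩ := p
  fin_cases i
  · have h2 : ε • v (k, 0) + (y O - l • x O) * v (k, 1) -
        x O * shiftUp (fun k => v (k, 1)) k = 0 := by
      rw [← piMap_apply l ε hε.not_isUnit, hv]
      rfl
    have h3 : shiftUp (fun k => v (k, 1)) k = 0 := by simp [shiftUp, h1]
    rw [h1, h3, mul_zero, mul_zero, add_zero, sub_zero] at h2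
    exact (smul_eq_zero.1 h2).resolve_left hε.ne_zero
  · exact h1 k

/-- The second components `q` are forced by `z`, and the first ones require dividing `(Y - lX) q - X
shiftUp q` by `ε`. The two membership conditions make its coefficients divisible. -/
theorem exists_signedSnd_eq {n : ℕ} (l : O) {ε : O} (hε : Irreducible ε) {z : Fin n → A O}
    (hz : z ∈ Z n (-IsLocalRing.residue O l)) :
    ∃ v, piMap n l ε hε.not_isUnit v = 0 ∧ signedSnd n O v = z := by
  rw [mem_Z_neg_iff l hε] at hz
  let q (k : Fin n) : A O := (-1 : O) ^ k.val • z k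
  have hp (k : Fin n) : ∃ p : A O, ε • p = -((y O - l • x O) * q k - x O * shiftUp q k) := by
    have h0 := map_shiftUp (c0 (O := O)) c0_zero q k
    have hY := map_shiftUp (cY (O := O)) cY_zero q k
    simp only [q, c0_smul, cY_smul, shiftUp_neg_one_pow_mul] at h0 hY
    have h1 : ε ∣ shiftUp (fun j => c0 (z j)) k := by
      unfold shiftUp
      split_ifs
      · exact (hz _).1
      · exact dvd_zero _
    apply exists_smul_eq_of_dvd
    · simp
    · simp only [cX_neg, cX_sub, cX_mul, c0_sub, c0_smul, cX_smul, c0_x, c0_y, cX_x, cX_y, h0, q]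
      obtain ⟨a, ha⟩ := (hz k).1
      obtain ⟨b, hb⟩ := h1
      exact ⟨(-1) ^ k.val * (l * a - b), by rw [ha, hb]; ring⟩
    · simp only [cY_neg, cY_sub, cY_mul, c0_sub, c0_smul, cY_smul, c0_x, c0_y, cY_x, cY_y, q]
      obtain ⟨a, ha⟩ := (hz k).1
      exact ⟨-((-1) ^ k.val * a), by rw [ha]; ring⟩
    · simp only [cXY_neg, cXY_sub, cXY_smul, cXY_mul, c0_sub, cX_sub, cY_sub, c0_smul, cX_smul,
        cY_smul, c0_x, c0_y, cX_x, cX_y, cY_x, cY_y, cXY_x, cXY_y, hY, q]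
      obtain ⟨a, ha⟩ := (hz k).2
      exact ⟨-((-1) ^ k.val * a), by linear_combination (-(-1) ^ k.val) * ha⟩
  choose p hp using hp
  refine ⟨fun i => if i.2 = 0 then p i.1 else q i.1, ?_, ?_⟩
  · apply Subtype.ext
    funext k
    rw [piMap_apply]
    change ε • p k + (y O - l • x O) * q k - x O * shiftUp q k = 0
    rw [hp]
    abel
  · funext k
    rw [signedSnd_apply]
    change (-1 : O) ^ k.val • (-1 : O) ^ k.val • z k = z k
    rw [smul_smul, ← mul_pow]
    simp

/-- The kernel of `piMap` is the Heller lattice for the opposite parameter. -/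
theorem exists_exact_piMap (n : ℕ) (l : O) {ε : O} (hε : Irreducible ε) :
    ∃ ι : Z n (-IsLocalRing.residue O l) →ₗ[A O] (Fin n × Fin 2 → A O),
      Function.Injective ι ∧ Function.Exact ι (piMap n l ε hε.not_isUnit) := by
  let K := LinearMap.ker (piMap n l ε hε.not_isUnit)
  let f : K →ₗ[A O] Z n (-IsLocalRing.residue O l) :=
    (signedSnd n O ∘ₗ K.subtype).codRestrict _ fun v => signedSnd_mem l hε v.2
  have hf : Function.Bijective f := by
    constructor
    · rw [injective_iff_map_eq_zero]
      intro v hv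
      exact Subtype.ext (eq_zero_of_signedSnd_eq_zero l hε v.2 (congrArg Subtype.val hv))
    · intro z
      obtain ⟨v, hv, hvz⟩ := exists_signedSnd_eq l hε z.2
      exact ⟨⟨v, hv⟩, Subtype.ext hvz⟩
  let g := (LinearEquiv.ofBijective f hf).symm
  refine ⟨K.subtype ∘ₗ g.toLinearMap, Subtype.val_injective.comp g.injective, fun v => ?_⟩
  constructor
  · intro hv
    obtain ⟨z, hz⟩ := g.surjective ⟨v, hv⟩
    exact ⟨z, congrArg Subtype.val hz⟩
  · rintro ⟨z, rfl⟩
    exact (g z).2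

end Kernel

/-! ### Factoring `Φ` and its composites through `π` -/

section AlmostSplit

variable {O : Type u} [CommRing O] [IsDomain O] [IsDiscreteValuationRing O]

theorem cXY_Phi {n : ℕ} (hn : 0 < n) (c : IsLocalRing.ResidueField O) {ε : O} (hε : Irreducible ε)
    (z : Z n c) (j : Fin n) : cXY ((Phi n hn c ε hε z).1 j) =
      if j = ⟨n - 1, by omega⟩ then a1CoeffHom n c hε ⟨n - 1, by omega⟩ z else 0 := by
  change cXY (a1Coeff n c ε hε ⟨n - 1, by omega⟩ z •
    ((x O * y O) * (e ⟨n - 1, by omega⟩ : Fin n → A O) j)) = _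
  by_cases h : j = ⟨n - 1, by omega⟩
  · subst h; simp [e, a1CoeffHom_apply]
  · simp [e, h]

/-- `Φ` does not factor through `piMap`. -/
theorem piMap_comp_ne_Phi {n : ℕ} (hn : 0 < n) (l : O) {ε : O} (hε : Irreducible ε)
    (ρ : Z n (IsLocalRing.residue O l) →ₗ[A O] (Fin n × Fin 2 → A O)) :
    piMap n l ε hε.not_isUnit ∘ₗ ρ ≠ Phi n hn _ ε hε := by
  intro h
  set a := a1 n (IsLocalRing.residue O l) ε hε.not_isUnit with ha
  let q (k : Fin n) : Z n (IsLocalRing.residue O l) →ₗ[A O] A O := LinearMap.proj (k, 1) ∘ₗ ρ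
  have h1 (j : Fin n) : (Phi n hn _ ε hε (a j)).1 j =
      ε • ρ (a j) (j, 0) + (y O - l • x O) * q j (a j) - x O * shiftUp (fun k => q k (a j)) j := by
    rw [← h]
    exact piMap_apply l ε hε.not_isUnit (ρ (a j)) j
  have h2 (j : Fin n) : (y O - l • x O) * q j (a j) - x O * q j (shiftDown a j) =
      ε • q j (a3 n l j) := by
    rw [smul_map_a3 l ε hε.not_isUnit (q j) j, shiftMap_apply,
      map_shiftDown (q j) (map_zero (q j))]
    rfl
  -- Adjointness of the shifts moves the shift from the components of `ρ` to the generators, where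
  -- the relation for `ε a_{j,3}` applies.
  have h3 : ∑ j, shiftUp (fun k => q k (a j)) j = ∑ j, q j (shiftDown a j) := by
    rw [← sum_shiftUp_eq_sum_shiftDown
      (fun z (g : Z n (IsLocalRing.residue O l) →ₗ[A O] A O) => g z)
      (fun g => map_zero g) (fun z => rfl) a q]
    refine Finset.sum_congr rfl fun j _ => ?_
    exact (map_shiftUp (fun g : Z n (IsLocalRing.residue O l) →ₗ[A O] A O => g (a j)) rfl q j).symm
  -- The trace of `π ∘ ρ` is divisible by `ε`, whereas in that of `Φ` only the last index
  -- contributes, with `XY`-coefficient `1`.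
  have h4 : ∑ j, (Phi n hn _ ε hε (a j)).1 j =
      ε • ∑ j, (ρ (a j) (j, 0) + q j (a3 n l j)) := by
    rw [Finset.smul_sum]
    simp only [h1, smul_add, ← h2]
    rw [Finset.sum_sub_distrib, ← Finset.mul_sum, h3, Finset.mul_sum, ← Finset.sum_sub_distrib]
    exact Finset.sum_congr rfl fun j _ => add_sub_assoc _ _ _
  have h5 := congrArg cXY h4
  rw [cXY_sum, cXY_smul] at h5
  simp only [cXY_Phi, ha, a1CoeffHom_a1] at h5
  rw [Finset.sum_eq_single ⟨n - 1, by omega⟩ (fun j _ hj => by rw [if_neg hj])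
    (fun hj => absurd (Finset.mem_univ _) hj), if_pos rfl, if_pos rfl] at h5
  exact hε.not_isUnit (isUnit_of_dvd_one ⟨_, h5⟩)

/-- Converse of `smul_map_a3`: the map is `z ↦ (∑ zₖ wₖ) / ε`. The hypothesis on `w` makes the sum
divisible by `ε` on each `a_{k,3}`, after the shift is moved by adjointness. -/
theorem exists_lift_of_shiftMap_eq {n : ℕ} (l : O) {ε : O} (hε : Irreducible ε) {W : Type*}
    [AddCommGroup W] [Module O W] [Module (A O) W] [IsScalarTower O (A O) W]
    [Module.IsTorsionFree O W] {w w' : Fin n → W} (h : shiftMap n l W w = ε • w') :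
    ∃ ψ : Z n (IsLocalRing.residue O l) →ₗ[A O] W,
      ∀ k, ψ (a1 n _ ε hε.not_isUnit k) = w k := by
  let T : Z n (IsLocalRing.residue O l) →ₗ[A O] W :=
    Fintype.linearCombination (A O) w ∘ₗ Submodule.subtype _
  have hT (z : Z n (IsLocalRing.residue O l)) : T z = ∑ k, z.1 k • w k := rfl
  obtain ⟨ψ, hψ⟩ := exists_smul_eq hε.ne_zero T (fun z => by
    obtain ⟨v, rfl⟩ := piMap_surjective n l hε z
    refine ⟨∑ k, (v (k, 0) • w k + v (k, 1) • w' k), ?_⟩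
    have h1 (k : Fin n) : (y O - l • x O) • w k - x O • shiftDown w k = ε • w' k := congrFun h k
    have h2 : ∑ k, shiftUp (fun k => v (k, 1)) k • x O • w k =
        ∑ k, v (k, 1) • x O • shiftDown w k :=
      sum_shiftUp_eq_sum_shiftDown (fun (m : W) (b : A O) => b • x O • m)
        (fun b => (congrArg (b • ·) (smul_zero (x O))).trans (smul_zero b))
        (fun m => zero_smul (A O) (x O • m)) w (fun k => v (k, 1))
    have h3 (k : Fin n) : (piMap n l ε hε.not_isUnit v).1 k • w k = ε • v (k, 0) • w k +
        v (k, 1) • (y O - l • x O) • w k - shiftUp (fun k => v (k, 1)) k • x O • w k := by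
      rw [piMap_apply, sub_smul, add_smul, smul_assoc, mul_comm (y O - l • x O), mul_smul,
        mul_comm (x O), mul_smul]
    rw [hT, Finset.sum_congr rfl fun k _ => h3 k, Finset.sum_sub_distrib, h2,
      ← Finset.sum_sub_distrib, Finset.smul_sum]
    refine Finset.sum_congr rfl fun k _ => ?_
    rw [add_sub_assoc, ← smul_sub, h1, smul_add, smul_comm ε (v (k, 1)) (w' k)])
  refine ⟨ψ, fun k => smul_right_injective W hε.ne_zero ?_⟩
  change ε • ψ _ = ε • w k
  rw [hψ, hT, Finset.sum_eq_single k]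
  · change (ε • (e k : Fin n → A O) k) • w k = ε • w k
    simp [e]
  · intro j _ hj
    change (ε • (e k : Fin n → A O) j) • w j = 0
    rw [e, Pi.single_eq_of_ne hj, smul_zero]
    exact zero_smul (A O) (w j)
  · simp

theorem shiftDown_single {n : ℕ} {W : Type*} [AddCommMonoid W] (j : Fin n) (w : W) :
    shiftDown (Pi.single j w) = shiftUp (fun k => Pi.single k w) j := by
  funext i
  rw [map_shiftUp (fun f : Fin n → W => f i) rfl, shiftUp_eq_sum, shiftDown_eq_sum,
    Finset.sum_eq_single j, Finset.sum_eq_single i]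
  · simp
  · intro k _ hk
    simp [hk.symm]
  · simp
  · intro k _ hk
    simp [hk]
  · simp

/-- The composition of `Φ` with a non-retraction factors through `piMap`. -/
theorem exists_piMap_comp_eq {n : ℕ} (hn : 0 < n) (l : O) {ε : O} (hε : Irreducible ε)
    {W : Type u} [AddCommGroup W] [Module O W] [Module (A O) W] [IsScalarTower O (A O) W]
    (hW : IsLattice O W) (h : W →ₗ[A O] Z n (IsLocalRing.residue O l)) (hh : ¬ IsRetraction h) :
    ∃ ρ : W →ₗ[A O] (Fin n × Fin 2 → A O),
      piMap n l ε hε.not_isUnit ∘ₗ ρ = Phi n hn _ ε hε ∘ₗ h := by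
  have := hW.1
  have := hW.2
  let χ : Z n (IsLocalRing.residue O l) →ₗ[O] O := a1CoeffHom n _ hε ⟨n - 1, by omega⟩
  let φ : (Fin n → W) →ₗ[O] O := χ ∘ₗ h.restrictScalars O ∘ₗ LinearMap.proj ⟨n - 1, by omega⟩
  -- If `D w = ε w'`, then `w` defines `ψ : Z → W`, and `φ w` is the last diagonal entry of `h ∘ ψ`.
  -- Were it prime to `ε`, `h ∘ ψ` would be bijective and `h` a retraction.
  obtain ⟨q, p, hqp⟩ := exists_eq_comp_add_smul hε (shiftMap n l W) φ (fun w w' hw => by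
    obtain ⟨ψ, hψ⟩ := exists_lift_of_shiftMap_eq l hε hw
    by_contra hd
    apply hh
    apply isRetraction_of_bijective_comp (f := ψ)
    apply bijective_of_not_dvd hn hε
    rwa [LinearMap.comp_apply, hψ])
  let P (k : Fin n) : W →ₗ[A O] A O := ofFunctional (p ∘ₗ LinearMap.single O (fun _ => W) k)
  let Q (k : Fin n) : W →ₗ[A O] A O := ofFunctional (q ∘ₗ LinearMap.single O (fun _ => W) k)
  have hP (k : Fin n) (w : W) : cXY (P k w) = p (Pi.single k w) := cXY_ofFunctional _ _
  have hQ (k : Fin n) (w : W) : cXY (Q k w) = q (Pi.single k w) := cXY_ofFunctional _ _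
  let ρ : W →ₗ[A O] (Fin n × Fin 2 → A O) :=
    LinearMap.pi fun i => if i.2 = 0 then P i.1 else Q i.1
  -- On `XY`-coefficients, the `j`-th coordinate of the required equation is `φ = q ∘ D + ε p`
  -- evaluated at the tuple with the single entry `w` in place `j`.
  have key (j : Fin n) : LinearMap.proj j ∘ₗ Submodule.subtype _ ∘ₗ
      (piMap n l ε hε.not_isUnit ∘ₗ ρ) =
      LinearMap.proj j ∘ₗ Submodule.subtype _ ∘ₗ (Phi n hn _ ε hε ∘ₗ h) := by
    apply linearMap_ext_cXY
    intro w
    change cXY ((piMap n l ε hε.not_isUnit (ρ w)).1 j) = cXY ((Phi n hn _ ε hε (h w)).1 j)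
    rw [cXY_Phi, piMap_apply]
    change cXY (ε • P j w + (y O - l • x O) • Q j w - x O • shiftUp (fun k => Q k w) j) = _
    have h1 : x O • shiftUp (fun k => Q k w) j = shiftUp (fun k => Q k (x O • w)) j := by
      rw [map_shiftUp (fun b : A O => x O • b) (smul_zero _)]
      simp only [map_smul]
    have h2 := hqp (Pi.single j w)
    have h3 : shiftMap n l W (Pi.single j w) = Pi.single j ((y O - l • x O) • w) -
        shiftUp (fun k => Pi.single k (x O • w)) j := by
      funext i
      rw [← shiftDown_single, shiftMap_apply, Pi.sub_apply,
        map_shiftDown (fun m : W => x O • m) (smul_zero _)]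
      congr 1
      · by_cases hi : i = j
        · subst hi; simp
        · simp [hi]
      · congr 1
        funext i'
        by_cases hi : i' = j
        · subst hi; simp
        · simp [hi]
    have h4 : φ (Pi.single j w) = if j = ⟨n - 1, by omega⟩ then χ (h w) else 0 := by
      change χ (h ((Pi.single j w : Fin n → W) ⟨n - 1, by omega⟩)) = _
      by_cases hj : j = ⟨n - 1, by omega⟩
      · subst hj; simp
      · rw [Pi.single_eq_of_ne (Ne.symm hj), map_zero, map_zero, if_neg hj]
    rw [h1, ← (Q j).map_smul, cXY_sub, cXY_add, cXY_smul, hP, hQ,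
      map_shiftUp (cXY (O := O)) cXY_zero, ← h4, h2, h3, map_sub, map_shiftUp q (map_zero q)]
    simp only [hQ]
    ring
  refine ⟨ρ, ?_⟩
  ext1 w
  apply Subtype.ext
  funext j
  exact LinearMap.congr_fun (key j) w

end AlmostSplit
end SymKron

/-! ### The almost split sequence -/

theorem proposition3 {O : Type u} [CommRing O] [IsDomain O] [IsDiscreteValuationRing O]
    [IsAdicComplete (IsLocalRing.maximalIdeal O) O]
    [IsAlgClosed (IsLocalRing.ResidueField O)]
    (ε : O) (hε : Irreducible ε) (n : ℕ) (hn : 0 < n) (l : O) :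
    SymKron.IsProjectiveCover (SymKron.piMap n l ε hε.not_isUnit) ∧
    (∃ ι : SymKron.Z n (-(IsLocalRing.residue O l)) →ₗ[SymKron.A O] (Fin n × Fin 2 → SymKron.A O),
      Function.Injective ι ∧ Function.Exact ι (SymKron.piMap n l ε hε.not_isUnit)) ∧
    ∀ (ι : SymKron.Z n (-(IsLocalRing.residue O l)) →ₗ[SymKron.A O]
          (Fin n × Fin 2 → SymKron.A O))
      (_ : Function.Injective ι)
      (hι : Function.Exact ι (SymKron.piMap n l ε hε.not_isUnit)),
      SymKron.IsAlmostSplit O (SymKron.A O)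
        (SymKron.Z n (-(IsLocalRing.residue O l))) (SymKron.E n hn l ε hε)
        (SymKron.Z n (IsLocalRing.residue O l))
        (SymKron.toE n hn l ε hε ι hι.linearMap_comp_eq_zero)
        (SymKron.EtoZ n hn l ε hε) := by
  refine ⟨SymKron.isProjectiveCover_piMap n l hε, SymKron.exists_exact_piMap n l hε, ?_⟩
  intro ι hinj hι
  have := SymKron.nontrivial_Z hn (-(IsLocalRing.residue O l))
  have := SymKron.nontrivial_Z hn (IsLocalRing.residue O l)
  refine SymKron.isAlmostSplit_of_lift (SymKron.isLattice_Z _ _)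
    (((SymKron.isLattice_pi _).prod (SymKron.isLattice_Z _ _)).submodule _)
    (SymKron.isLattice_Z _ _) ?_ ?_ ?_ (SymKron.hasLocalEnd_Z hn _) (SymKron.hasLocalEnd_Z hn _)
    ?_ ?_
  · intro z z' h
    exact hinj (congrArg (fun t => t.1.1) h)
  · rintro ⟨⟨v, z⟩, hvz⟩
    constructor
    · rintro (rfl : z = 0)
      obtain ⟨t, rfl⟩ := (hι v).1 ((show _ = _ from hvz).trans (map_zero (SymKron.Phi n hn _ ε hε)))
      exact ⟨t, rfl⟩
    · rintro ⟨t, ht⟩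
      exact (congrArg (fun t => t.1.2) ht).symm
  · intro z
    obtain ⟨v, hv⟩ := SymKron.piMap_surjective n l hε (SymKron.Phi n hn _ ε hε z)
    exact ⟨⟨(v, z), hv⟩, rfl⟩
  -- The first component of a section of `E → Z` would factor `Φ` through `π`.
  · rintro ⟨σ, hσ⟩
    refine SymKron.piMap_comp_ne_Phi hn l hε
      (LinearMap.fst _ _ _ ∘ₗ Submodule.subtype _ ∘ₗ σ) ?_
    ext1 z
    have h1 : (σ z).1.2 = z := LinearMap.congr_fun hσ z
    have h2 : SymKron.piMap n l ε hε.not_isUnit (σ z).1.1 =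
      SymKron.Phi n hn _ ε hε (σ z).1.2 := (σ z).2
    rw [h1] at h2
    exact h2
  -- A factorization `ρ` of `Φ ∘ h` through `π` gives the lift `w ↦ (ρ w, h w)`.
  · intro W _ _ _ _ hW h hh
    obtain ⟨ρ, hρ⟩ := SymKron.exists_piMap_comp_eq hn l hε hW h hh
    exact ⟨(ρ.prod h).codRestrict _ fun w => LinearMap.congr_fun hρ w, rfl⟩
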